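/- Let $W$ be a complete discrete valuation ring with uniformizer $\pi$ and normalized valuation $\mathrm{val}$. Let $d\ge 1$ and $N\ge 0$ be integers, and let $A,B\in W[X]$ be monic of degree $d$. For $0\le j<d$, consider the truncated Sylvester map $$\psi_j:\ (U,V)\mapsto AU+BV \bmod W_{<j}[X],\qquad W_{<d-j}[X]\times W_{<d-j}[X]\to W_{<2d-j}[X]/W_{<j}[X],$$ with the ordered bases $(X^{d-j-1},0),\dots,(1,0),(0,X^{d-j-1}),\dots,(0,1)$ and $X^{2d-j-1},\dots,X^{j}$. Let $r_j=\det\psi_j$ be the $j$-th principal subresultant. Let $(F_j,G_j)$ be the solution of $\psi_j(F,G)=r_jX^j$ given by Cramer's formula, let $R_j=AF_j+BG_j$ be the $j$-th subresultant, and let $V_j=\mathrm{val}(r_j)\in\mathbb N\cup\{+\infty\}$. Consider the following *stabilized subresultant algorithm*, whose input is $A,B$ known at flat precision $O(\pi^N)$ (every coefficient is known modulo $\pi^N$; the leading coefficients are exactly $1$). 1. Set $R_d\leftarrow B$, $r_d\leftarrow 1$, $R_{d-1}\leftarrow B-A$. 2. For $j=d-1,d-2,\dots,1$: - let $r_j$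 be the coefficient of $X^j$ in $R_j$ and $v_j$ its valuation; if $v_j\ge N/2$, stop and return an error; - bring $(R_{j+1},R_j)$ to precision $O(\pi^{N+2\mathrm{val}(r_j)+2\mathrm{val}(r_{j+1})})$, by choosing arbitrarily the digits that are not known (and by truncating when more digits are known); $R_d$ stays monic; - set $R_{j-1}\leftarrow \mathrm{prem}(R_{j+1},R_j)/r_{j+1}^2$, known at precision $O(\pi^{N+2\mathrm{val}(r_j)})$, where $\mathrm{prem}(R_{j+1},R_j)=r_j^2\cdot(R_{j+1}\,\%\,R_j)$ is computed by the schoolbook pseudo-division and $\%$ is the remainder of Euclidean division. 3. Return $R_{d-1}+O(\pi^N),\dots,R_0+O(\pi^N)$. Assume **(H)** no principal subresultant $r_0,\dots,r_{d-1}$ of $(A,B)$ vanishes modulo $\pi^{N/2}$, i.e. $V_j<N/2$ for $0\le j<d$. Then, whatever choices are made in the lifting steps: * *(correctness)* the algorithm terminates without error and returns all subresultants $R_{d-1},\dots,R_0$ of $(A,B)$ modulo $\pi^N$; * *(complexity)* it uses $O\big(d^2\cdot \mathtt M(N+\max(V_0,\dots,V_{d-1}))\big)$ bit operations. Here $\mathtt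 M(n)$ is the number of bit operations charged for one operation on elements of $W$ at precision $O(\pi^n)$ (subtraction, product, exact division, and also reading a valuation or changing the precision of an element). As usual for such cost functions, $\mathtt M$ is nondecreasing and $\mathtt M(2n)\le c\,\mathtt M(n)$ for all $n\ge1$, for some constant $c$. The implied constant is $c$ times an absolute constant. If instead $V_j\ge N/2$ for some $1\le j\le d-1$, then the algorithm returns an error. -/

import Mathlib

namespace StableSubres

open Polynomial

universe u v

/-! ### Subresultants

`A` and `B` are polynomials over a commutative ring, `dA ≥ deg A`, `dB ≥ deg B` and
`0 ≤ j < min dA dB`.  The truncated Sylvester map sends `(U, V)`, with `deg U < dB - j` and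
`deg V < dA - j`, to the class of `A * U + B * V` modulo the polynomials of degree `< j`. -/

section Subresultants

variable {R : Type u} [CommRing R]

/-- The image under `(U, V) ↦ A * U + B * V` of the `c`-th vector of the ordered basis
`(X^(dB-j-1), 0), …, (1, 0), (0, X^(dA-j-1)), …, (0, 1)`. -/
noncomputable def sylvesterColumn (dA dB j : ℕ) (A B : R[X]) (c : ℕ) : R[X] :=
  if c < dB - j then X ^ (dB - j - 1 - c) * A else X ^ (dA - j - 1 - (c - (dB - j))) * B

/-- The matrix of the truncated Sylvester map; the ordered basis of the target is
`X^(dA+dB-j-1), …, X^j`. -/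
noncomputable def sylvesterMatrix (dA dB j : ℕ) (A B : R[X]) :
    Matrix (Fin ((dB - j) + (dA - j))) (Fin ((dB - j) + (dA - j))) R :=
  fun r c => (sylvesterColumn dA dB j A B c).coeff (dA + dB - j - 1 - r)

/-- The `j`-th principal subresultant, computed in degree `(dA, dB)`. -/
noncomputable def principalSubres (dA dB j : ℕ) (A B : R[X]) : R :=
  (sylvesterMatrix dA dB j A B).det

/-- Coordinates of the `j`-th cofactors `(U_j, V_j)` given by Cramer's formula: the solution of
`A * U + B * V ≡ det * X^j` modulo polynomials of degree `< j`.  The right-hand side `X^j` is the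
last vector of the basis of the target. -/
noncomputable def cofactorCoords (dA dB j : ℕ) (A B : R[X]) :
    Fin ((dB - j) + (dA - j)) → R :=
  Matrix.cramer (sylvesterMatrix dA dB j A B)
    (fun r => if (r : ℕ) + 1 = (dB - j) + (dA - j) then 1 else 0)

/-- The `j`-th cofactor of `A`. -/
noncomputable def cofactorU (dA dB j : ℕ) (A B : R[X]) : R[X] :=
  ∑ c : Fin ((dB - j) + (dA - j)),
    if (c : ℕ) < dB - j then C (cofactorCoords dA dB j A B c) * X ^ (dB - j - 1 - (c : ℕ)) else 0

/-- The `j`-th cofactor of `B`. -/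
noncomputable def cofactorV (dA dB j : ℕ) (A B : R[X]) : R[X] :=
  ∑ c : Fin ((dB - j) + (dA - j)),
    if (c : ℕ) < dB - j then 0
    else C (cofactorCoords dA dB j A B c) * X ^ (dA - j - 1 - ((c : ℕ) - (dB - j)))

/-- The `j`-th subresultant, computed in degree `(dA, dB)`. -/
noncomputable def subres (dA dB j : ℕ) (A B : R[X]) : R[X] :=
  A * cofactorU dA dB j A B + B * cofactorV dA dB j A B

end Subresultants

/-! ### Computations with a log

A `Run α` is the outcome of executing a program: its return value (`none` when an error has been
raised) and the log of all primitive operations executed so far.  Each entry of the log is the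
absolute precision at which one primitive operation was performed. -/

/-- The outcome of a program execution. -/
structure Run (α : Type u) where
  /-- The returned value, `none` if an error was raised. -/
  result : Option α
  /-- The precisions of the primitive operations that were executed, in order. -/
  log : List ℕ

namespace Run

/-- Return a value, at no cost. -/
def ret {α : Type u} (a : α) : Run α := ⟨some a, []⟩

/-- Raise an error. -/
def error {α : Type u} : Run α := ⟨none, []⟩

/-- One primitive operation at absolute precision `n`, with value `a`. -/
def tick {α : Type u} (n : ℕ) (a : α) : Run α := ⟨some a, [n]⟩

/-- Sequential composition. -/
def bind {α : Type u} {β : Type v} (x : Run α) (f : α → Run β) : Run β :=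
  match x.result with
  | none => ⟨none, x.log⟩
  | some a => ⟨(f a).result, x.log ++ (f a).log⟩

/-- Execute `f 0, …, f (k - 1)` in this order and return the sequence of the results
(extended by `0`). -/
def forEach {α : Type u} [Zero α] : ℕ → (ℕ → Run α) → Run (ℕ → α)
  | 0, _ => ret fun _ => 0
  | k + 1, f => (forEach k f).bind fun g => (f k).bind fun a => ret (Function.update g k a)

/-- The number of bit operations of an execution when a primitive operation at precision
`O(π^n)` takes `M n` bit operations. -/
def bitCost {α : Type u} (M : ℕ → ℕ) (x : Run α) : ℕ := (x.log.map M).sum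

end Run

/-! ### Approximations modulo powers of a uniformizer -/

section Approximations

variable {W : Type u} [CommRing W]

/-- Elements of `W` known at absolute precision `O(π^n)`, that is, balls `a + π^n W`. -/
abbrev Approx (π : W) (n : ℕ) : Type u := W ⧸ Ideal.span ({π ^ n} : Set W)

/-- The approximation `a + O(π^n)` of `a`. -/
abbrev approx (π : W) (n : ℕ) : W →+* Approx π n := Ideal.Quotient.mk (Ideal.span ({π ^ n} : Set W))

/-- Multiplication at precision `O(π^n)`. -/
def mul {π : W} {n : ℕ} (a b : Approx π n) : Run (Approx π n) := Run.tick n (a * b)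

/-- Subtraction at precision `O(π^n)`. -/
def sub {π : W} {n : ℕ} (a b : Approx π n) : Run (Approx π n) := Run.tick n (a - b)

open Classical in
/-- Exact division, at precision `O(π^(n+w))`, of `a` by an element `b` of valuation `w`.  The
quotient is only known at precision `O(π^n)`, where it is unique.  (If `b` does not divide `a`
the value is `0`.) -/
noncomputable def quo {π : W} {n w : ℕ} (a b : Approx π (n + w)) : Run (Approx π n) :=
  Run.tick (n + w)
    (if h : ∃ q : W, approx π (n + w) q * b = a then approx π n (Classical.choose h) else 0)

open Classical in
/-- The valuation of an element known at precision `O(π^n)`; it is `n` if all known digits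
vanish. -/
noncomputable def valuation {π : W} {n : ℕ} (a : Approx π n) : Run ℕ :=
  Run.tick n (Nat.findGreatest (fun k => approx π n π ^ k ∣ a) n)

/-- Forget digits: from precision `O(π^(N+e))` to precision `O(π^N)`. -/
def truncate {π : W} {N e : ℕ} (a : Approx π (N + e)) : Approx π N :=
  Ideal.Quotient.factor (S := Ideal.span ({π ^ (N + e)} : Set W))
    (T := Ideal.span ({π ^ N} : Set W))
    (Ideal.span_singleton_le_span_singleton.mpr (pow_dvd_pow π (Nat.le_add_right N e))) a

/-- A strategy for changing the precision of an approximation from `O(π^m)` to `O(π^n)`.  The only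
requirement is that the old and the new ball meet: for `n ≥ m` the new ball is an arbitrary
ball of radius `π^n` inside the old one (a lift), for `n ≤ m` it is the truncation.  The choice
may depend on the place in the program: `j` is the iteration, `s` tells which of the two
polynomials is being lifted, `i` is the index of the coefficient. -/
structure LiftStrategy (π : W) where
  /-- The new approximation. -/
  lift : (j s i m n : ℕ) → Approx π m → Approx π n
  /-- The old and the new ball have a common element. -/
  meets : ∀ (j s i m n : ℕ) (x : Approx π m),
    ∃ a : W, approx π m a = x ∧ approx π n a = lift j s i m n x

/-- Lifting strategies exist: choose any representative. -/
noncomputable instance (π : W) : Inhabited (LiftStrategy π) where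
  default :=
    { lift := fun _ _ _ _ n x => approx π n (Quotient.out x)
      meets := fun _ _ _ _ _ x => ⟨Quotient.out x, Quotient.out_eq x, rfl⟩ }

/-! ### The algorithm

Polynomials known at flat precision `O(π^n)` are given by their coefficient sequences
`ℕ → Approx π n`. -/

/-- Change the precision of the first `k` coefficients of a polynomial to `O(π^n)`. -/
def liftPoly {π : W} (L : LiftStrategy π) (j s k : ℕ) {m : ℕ} (n : ℕ) (P : ℕ → Approx π m) :
    Run (ℕ → Approx π n) :=
  Run.forEach k fun i => Run.tick n (L.lift j s i m n (P i))

/-- The pseudo-remainder `prem(P, Q) = lc(Q)^2 * (P % Q)` of a polynomial `P` of degree `j + 1`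
by a polynomial `Q` of degree `j`: with `q` and `p` the leading coefficients of `Q` and `P`, put
`S = q * P - p * X * Q`, of degree at most `j`; the pseudo-remainder is `q * S - s * Q`, where `s`
is the coefficient of degree `j` in `S`. -/
def pseudoRem {π : W} {n : ℕ} (j : ℕ) (P Q : ℕ → Approx π n) : Run (ℕ → Approx π n) :=
  (Run.forEach (j + 1) fun i =>
    (mul (Q j) (P i)).bind fun a =>
    (mul (P (j + 1)) (if i = 0 then 0 else Q (i - 1))).bind fun b =>
    sub a b).bind fun S =>
  Run.forEach j fun i =>
    (mul (Q j) (S i)).bind fun a =>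
    (mul (S j) (Q i)).bind fun b =>
    sub a b

/-- The main loop, run for the indices `j, j - 1, …, 1`.  At the start of iteration `j`, the
arguments are `w = val r_{j+1}` (with `w = 0` if `j + 1 = d`), `P = R_{j+1}`, `Q = R_j`, and the
subresultants `R_{d-1}, …, R_j` already computed, truncated at precision `O(π^N)`.  Since `R_d` is
monic, its leading coefficient is exactly `1` at every precision. -/
noncomputable def mainLoop {π : W} (L : LiftStrategy π) (d N : ℕ) :
    (j : ℕ) → {m n : ℕ} → (w : ℕ) → (P : ℕ → Approx π m) → (Q : ℕ → Approx π n) →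
    (out : ℕ → ℕ → Approx π N) → Run (ℕ → ℕ → Approx π N)
  | 0, _, _, _, _, _, out => Run.ret out
  | j + 1, _, _, w, P, Q, out =>
    (valuation (Q (j + 1))).bind fun v =>
    if N ≤ 2 * v then Run.error
    else
      (liftPoly L (j + 1) 0 (j + 3) (N + 2 * v + 2 * w) P).bind fun P₀ =>
      (liftPoly L (j + 1) 1 (j + 2) (N + 2 * v + 2 * w) Q).bind fun Q' =>
      let P' := if j + 2 = d then Function.update P₀ d 1 else P₀
      (pseudoRem (j + 1) P' Q').bind fun S =>
      (mul (P' (j + 2)) (P' (j + 2))).bind fun t =>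
      (Run.forEach (j + 1) fun i => quo (n := N + 2 * v) (w := 2 * w) (S i) t).bind fun R =>
      mainLoop L d N j v Q' R (Function.update out j fun i => truncate (R i))

/-- The stabilized subresultant pseudo-remainder sequence algorithm, on two monic polynomials of
degree `d` known at flat precision `O(π^N)`.  The coefficient of `X^i` in the `j`-th polynomial
returned, for `j < d`, is the value of the output at `j`, `i`. -/
noncomputable def stabilizedSubres {π : W} (L : LiftStrategy π) (d N : ℕ)
    (A B : (Approx π N)[X]) : Run (ℕ → ℕ → Approx π N) :=
  (Run.forEach d fun i => sub (B.coeff i) (A.coeff i)).bind fun D =>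
  mainLoop L d N (d - 1) 0 B.coeff D (Function.update (fun _ _ => 0) (d - 1) D)

end Approximations

/-- The largest of the valuations `V_0, …, V_{d-1}` of the principal subresultants of two monic
polynomials of degree `d` (meant for the case where all of them are nonzero). -/
noncomputable def maxVal {W : Type u} [CommRing W] [IsDomain W] [IsDiscreteValuationRing W]
    (d : ℕ) (A B : W[X]) : ℕ :=
  (Finset.range d).sup fun j =>
    (IsDiscreteValuationRing.addVal W (principalSubres d d j A B)).toNat

end StableSubres

/-! Arbitrary digits are harmless because they can be absorbed into the input. Let U_k, V_k be the
cofactors of R_k. The pair (R_{j+1}, R_j) is the image of (A, B) under the matrix with rows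
(U_{j+1}, V_{j+1}) and (U_j, V_j), of determinant ± r_{j+1}^2 (`extU_mul_extV_sub`). Its adjugate
therefore turns an error in π^N r_{j+1}^2 on (R_{j+1}, R_j) into an error in π^N on (A, B), with the
cofactors kept. The new pair does have these cofactors: its cross product with the old pair has low
degree, so r_{j+1} is unchanged (`principalSubres_eq_of_natDegree_le`), and injectivity of the
Sylvester map identifies them. Only monicity may be lost, and a scalar repairs it. This is
`exists_lift`.

Hence the invariant `LoopInvariant`: the current polynomials, known to at least N + 2w digits with w
= val r_{j+1}, approximate u times two consecutive subresultants of some pair (A', B') congruent to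
(A, B) modulo π^N, with u congruent to 1. Lifting amounts to choosing representatives in W; by
`exists_lift` these are exactly a scalar times the subresultants of another such pair, for which the
recurrence `extSubres_recurrence` holds in W. The division is thus exact and costs only the 2w extra
digits. Subresultants commute with reduction modulo π^N, so the outputs, and the valuations below N,
are those of (A, B).

Since 2w < N, every working precision N + 2v + 2w is at most twice N + max V_j, and an iteration
takes at most 9d operations. If some V_j with 1 ≤ j is at least N/2, the invariant survives down to
the first such index met, where the test raises the error. -/

namespace StableSubres

open Polynomial

universe u v

/-! ### Cofactors, Cramer's formula and injectivity of the truncated Sylvester map. -/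

section SylvesterAlgebra

variable {R : Type u} [CommRing R]

/-- The polynomial of degree `< n` with the `n` coefficients `x 0, …, x (n - 1)`, in decreasing
degrees. -/
noncomputable def ofCoords (n : ℕ) (x : ℕ → R) : R[X] :=
  ∑ c ∈ Finset.range n, C (x c) * X ^ (n - 1 - c)

theorem coeff_ofCoords (n : ℕ) (x : ℕ → R) (i : ℕ) :
    (ofCoords n x).coeff i = if i < n then x (n - 1 - i) else 0 := by
  unfold ofCoords
  rw [finsetSum_coeff]
  simp only [coeff_C_mul, coeff_X_pow]
  split_ifs with h
  · rw [Finset.sum_eq_single (n - 1 - i)]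
    · rw [if_pos (by omega), mul_one]
    · intro b hb hne
      rw [Finset.mem_range] at hb
      rw [if_neg (by omega), mul_zero]
    · intro hb
      exact absurd (Finset.mem_range.2 (by omega)) hb
  · refine Finset.sum_eq_zero fun c hc => ?_
    rw [Finset.mem_range] at hc
    rw [if_neg (by omega), mul_zero]

theorem eq_ofCoords {n : ℕ} {U : R[X]} (hU : ∀ i, n ≤ i → U.coeff i = 0) :
    U = ofCoords n fun c => U.coeff (n - 1 - c) := by
  ext i
  rw [coeff_ofCoords]
  split_ifs with h
  · congr 1; omega
  · exact hU i (by omega)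

theorem natDegree_ofCoords_le (n : ℕ) (x : ℕ → R) : (ofCoords n x).natDegree ≤ n - 1 := by
  rw [natDegree_le_iff_coeff_eq_zero]
  intro i hi
  rw [coeff_ofCoords, if_neg (by omega)]

theorem sylvesterColumn_sum (d k : ℕ) (A B : R[X]) (x : ℕ → R) :
    ∑ c ∈ Finset.range ((d - k) + (d - k)), C (x c) * sylvesterColumn d d k A B c =
      A * ofCoords (d - k) x + B * ofCoords (d - k) fun c => x (d - k + c) := by
  rw [Finset.sum_range_add]
  congr 1
  · unfold ofCoords
    rw [Finset.mul_sum]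
    refine Finset.sum_congr rfl fun c hc => ?_
    rw [Finset.mem_range] at hc
    rw [sylvesterColumn, if_pos hc]
    ring
  · unfold ofCoords
    rw [Finset.mul_sum]
    refine Finset.sum_congr rfl fun c hc => ?_
    rw [sylvesterColumn, if_neg (by omega), Nat.add_sub_cancel_left]
    ring

/-- The cofactor coordinates, extended by zero. -/
noncomputable def cofactorSeq (d k : ℕ) (A B : R[X]) (c : ℕ) : R :=
  if h : c < (d - k) + (d - k) then cofactorCoords d d k A B ⟨c, h⟩ else 0

theorem cofactorSeq_coe (d k : ℕ) (A B : R[X]) (c : Fin ((d - k) + (d - k))) :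
    cofactorCoords d d k A B c = cofactorSeq d k A B c := by
  rw [cofactorSeq, dif_pos c.2]

theorem cofactorU_eq (d k : ℕ) (A B : R[X]) :
    cofactorU d d k A B = ofCoords (d - k) (cofactorSeq d k A B) := by
  unfold cofactorU
  simp only [cofactorSeq_coe]
  rw [Fin.sum_univ_eq_sum_range (fun c => if c < d - k then
    C (cofactorSeq d k A B c) * X ^ (d - k - 1 - c) else 0), Finset.sum_range_add]
  rw [Finset.sum_congr rfl fun c hc => if_pos (Finset.mem_range.1 hc),
    Finset.sum_eq_zero (s := Finset.range (d - k)) (f := fun c => if d - k + c < d - k then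
      C (cofactorSeq d k A B (d - k + c)) * X ^ (d - k - 1 - (d - k + c)) else 0)
      fun c _ => if_neg (by omega), add_zero]
  rfl

theorem cofactorV_eq (d k : ℕ) (A B : R[X]) :
    cofactorV d d k A B = ofCoords (d - k) fun c => cofactorSeq d k A B (d - k + c) := by
  unfold cofactorV
  simp only [cofactorSeq_coe]
  rw [Fin.sum_univ_eq_sum_range (fun c => if c < d - k then 0 else
    C (cofactorSeq d k A B c) * X ^ (d - k - 1 - (c - (d - k)))), Finset.sum_range_add]
  rw [Finset.sum_eq_zero fun c hc => if_pos (Finset.mem_range.1 hc), zero_add]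
  unfold ofCoords
  refine Finset.sum_congr rfl fun c _ => ?_
  rw [if_neg (by omega), Nat.add_sub_cancel_left]

theorem natDegree_cofactorU_le (d k : ℕ) (A B : R[X]) :
    (cofactorU d d k A B).natDegree ≤ d - k - 1 := by
  rw [cofactorU_eq]; exact natDegree_ofCoords_le _ _

theorem natDegree_cofactorV_le (d k : ℕ) (A B : R[X]) :
    (cofactorV d d k A B).natDegree ≤ d - k - 1 := by
  rw [cofactorV_eq]; exact natDegree_ofCoords_le _ _

/-- Coefficients of `A * U + B * V` are the coordinates of the image under the Sylvester map. -/
theorem sylvesterMatrix_mulVec (d k : ℕ) (A B : R[X]) (x : ℕ → R)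
    (r : Fin ((d - k) + (d - k))) :
    (sylvesterMatrix d d k A B).mulVec (fun c => x c) r =
      (A * ofCoords (d - k) x + B * ofCoords (d - k) fun c => x (d - k + c)).coeff
        (d + d - k - 1 - r) := by
  rw [← sylvesterColumn_sum, finsetSum_coeff, ← Fin.sum_univ_eq_sum_range
    (fun c => (C (x c) * sylvesterColumn d d k A B c).coeff (d + d - k - 1 - r))]
  simp only [Matrix.mulVec, dotProduct, sylvesterMatrix, coeff_C_mul]
  exact Finset.sum_congr rfl fun c _ => mul_comm _ _

/-- Cramer's vector is sent by the Sylvester matrix to the determinant times the last basis vector;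
in degrees beyond the rows of the matrix, the degree bounds on the cofactors suffice. -/
theorem coeff_subres {d k : ℕ} (hk : k < d) {A B : R[X]} (hA : A.natDegree ≤ d)
    (hB : B.natDegree ≤ d) {i : ℕ} (hi : k ≤ i) :
    (subres d d k A B).coeff i = if i = k then principalSubres d d k A B else 0 := by
  by_cases h : i ≤ d + d - k - 1
  · have key := congrFun (Matrix.mulVec_cramer (sylvesterMatrix d d k A B)
      (fun r => if (r : ℕ) + 1 = (d - k) + (d - k) then 1 else 0))
      ⟨d + d - k - 1 - i, by omega⟩
    change (sylvesterMatrix d d k A B).mulVec (cofactorCoords d d k A B) _ = _ at key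
    rw [show cofactorCoords d d k A B = fun c : Fin _ => cofactorSeq d k A B c from
      funext fun c => cofactorSeq_coe d k A B c, sylvesterMatrix_mulVec] at key
    rw [subres, cofactorU_eq, cofactorV_eq]
    rw [show d + d - k - 1 - (d + d - k - 1 - i) = i by omega] at key
    rw [key, Pi.smul_apply, smul_eq_mul, principalSubres]
    dsimp only
    by_cases hik : i = k
    · rw [if_pos (by omega), if_pos hik, mul_one]
    · rw [if_neg (by omega), if_neg hik, mul_zero]
  · rw [if_neg (by omega)]
    apply coeff_eq_zero_of_natDegree_lt
    unfold subres
    refine lt_of_le_of_lt (natDegree_add_le_of_degree_le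
      (n := d + (d - k - 1)) ?_ ?_) (by omega)
    · exact natDegree_mul_le_of_le hA (natDegree_cofactorU_le _ _ _ _)
    · exact natDegree_mul_le_of_le hB (natDegree_cofactorV_le _ _ _ _)

/-- The truncated Sylvester map is injective when its determinant does not vanish. -/
theorem eq_zero_of_principalSubres_ne_zero [IsDomain R] {d k : ℕ} (hk : k ≤ d) {A B U V : R[X]}
    (hr : principalSubres d d k A B ≠ 0) (hU : ∀ i, d - k ≤ i → U.coeff i = 0)
    (hV : ∀ i, d - k ≤ i → V.coeff i = 0) (h : ∀ i, k ≤ i → (A * U + B * V).coeff i = 0) :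
    U = 0 ∧ V = 0 := by
  set x : ℕ → R := fun c => if c < d - k then U.coeff (d - k - 1 - c) else
    V.coeff (d - k - 1 - (c - (d - k))) with hx
  have eU : U = ofCoords (d - k) x := by
    refine (eq_ofCoords hU).trans (Finset.sum_congr rfl fun c hc => ?_)
    rw [hx]
    simp only [if_pos (Finset.mem_range.1 hc)]
  have eV : V = ofCoords (d - k) fun c => x (d - k + c) := by
    refine (eq_ofCoords hV).trans (Finset.sum_congr rfl fun c hc => ?_)
    rw [hx]
    simp only [if_neg (show ¬ (d - k + c < d - k) by omega), Nat.add_sub_cancel_left]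
  have hz : (fun c : Fin ((d - k) + (d - k)) => x c) = 0 := by
    refine Matrix.eq_zero_of_mulVec_eq_zero (M := sylvesterMatrix d d k A B) hr ?_
    funext r
    rw [sylvesterMatrix_mulVec, ← eU, ← eV, Pi.zero_apply]
    exact h _ (by have := r.2; omega)
  have hz' : ∀ c < (d - k) + (d - k), x c = 0 := fun c hc => congrFun hz ⟨c, hc⟩
  constructor
  · rw [eU]
    refine Finset.sum_eq_zero fun c hc => ?_
    rw [hz' c (by have := Finset.mem_range.1 hc; omega), C_0, zero_mul]
  · rw [eV]
    refine Finset.sum_eq_zero fun c hc => ?_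
    dsimp only
    rw [hz' _ (by have := Finset.mem_range.1 hc; omega), C_0, zero_mul]

/-- The determinant of the square matrix with `K` rows and columns given by its entries. -/
noncomputable def detOf (K : ℕ) (f : ℕ → ℕ → R) : R :=
  Matrix.det (Matrix.of fun r c : Fin K => f r c)

theorem detOf_congr {K : ℕ} {f g : ℕ → ℕ → R} (h : ∀ r < K, ∀ c < K, f r c = g r c) :
    detOf K f = detOf K g := by
  unfold detOf
  congr 1
  ext r c
  exact h r r.2 c c.2

theorem detOf_succ_of_row_zero {K : ℕ} {f : ℕ → ℕ → R} (h0 : f 0 0 = 1)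
    (h : ∀ c < K, f 0 (c + 1) = 0) : detOf (K + 1) f = detOf K fun r c => f (r + 1) (c + 1) := by
  unfold detOf
  rw [Matrix.det_succ_row_zero, Fin.sum_univ_succ, Finset.sum_eq_zero]
  · simp only [Matrix.of_apply, Fin.val_zero, pow_zero, one_mul, h0, add_zero]
    congr 1
  · intro c _
    simp only [Matrix.of_apply, Fin.val_zero, Fin.val_succ, h c c.2, mul_zero, zero_mul]

/-- Laplace expansion along a column whose only nonzero entry is a 1 at the bottom; the minor skips
that column. -/
theorem detOf_succ_of_col {K : ℕ} {f : ℕ → ℕ → R} {m : ℕ} (hm : m ≤ K) (h0 : f K m = 1)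
    (h : ∀ r < K, f r m = 0) : detOf (K + 1) f =
      (-1) ^ (K + m) * detOf K fun r c => f r (if c < m then c else c + 1) := by
  unfold detOf
  rw [Matrix.det_succ_column _ ⟨m, by omega⟩, Finset.sum_eq_single (Fin.last K)]
  · simp only [Matrix.of_apply, Fin.val_last, h0, mul_one]
    congr 2
    ext r c
    simp only [Matrix.submatrix_apply, Matrix.of_apply, Fin.succAbove_last, Fin.val_castSucc]
    congr 1
    simp only [Fin.succAbove, Fin.lt_def, Fin.val_castSucc]
    split_ifs <;> simp
  · intro b _ hb
    have : (b : ℕ) < K := by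
      have := b.2
      have h2 : (b : ℕ) ≠ K := fun h3 => hb (Fin.ext h3)
      omega
    simp only [Matrix.of_apply, h b this, mul_zero, zero_mul]
  · intro hb; exact absurd (Finset.mem_univ _) hb

theorem principalSubres_eq_detOf (d k : ℕ) (A B : R[X]) :
    principalSubres d d k A B = detOf ((d - k) + (d - k))
      fun r c => (sylvesterColumn d d k A B c).coeff (d + d - k - 1 - r) := rfl

theorem principalSubres_self (d : ℕ) (A B : R[X]) : principalSubres d d d A B = 1 := by
  rw [principalSubres_eq_detOf, Nat.sub_self]
  exact Matrix.det_isEmpty (n := Fin 0)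

/-- The leading coefficient of the cofactor of `B` is, up to sign, the previous principal
subresultant. -/
theorem coeff_cofactorV {d j : ℕ} (hj : j < d) {A B : R[X]} (hA : A.Monic)
    (hAd : A.natDegree = d) (hB : B.natDegree ≤ d) :
    (cofactorV d d j A B).coeff (d - j - 1) =
      (-1) ^ (d - j - 1) * principalSubres d d (j + 1) A B := by
  obtain ⟨m, hm⟩ : ∃ m, d - j = m + 1 := ⟨d - j - 1, by omega⟩
  -- By Cramer, this coordinate is the Sylvester determinant with the column of X^(d-j-1) B replaced
  -- by the last basis vector.
  have e1 : (cofactorV d d j A B).coeff (d - j - 1) =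
      detOf ((d - j) + (d - j)) fun r c => if c = d - j then
        (if r + 1 = (d - j) + (d - j) then 1 else 0)
        else (sylvesterColumn d d j A B c).coeff (d + d - j - 1 - r) := by
    rw [cofactorV_eq, coeff_ofCoords, if_pos (by omega), Nat.sub_self, Nat.add_zero,
      cofactorSeq, dif_pos (by omega), cofactorCoords, Matrix.cramer_apply]
    unfold detOf
    congr 1
    ext r c
    rw [Matrix.updateCol_apply]
    simp only [Fin.ext_iff, Matrix.of_apply, sylvesterMatrix]
  have hX : ∀ (P : R[X]) (a e : ℕ), P.natDegree ≤ d → d + a < e →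
      (X ^ a * P).coeff e = 0 := by
    intro P a e hP he
    apply coeff_eq_zero_of_natDegree_lt
    refine lt_of_le_of_lt (natDegree_mul_le_of_le (natDegree_X_pow_le a) hP) (by omega)
  have e2 : (d - j) + (d - j) = (m + m + 1) + 1 := by omega
  have e3 : (d - (j + 1)) = m := by omega
  -- Expand along the replaced column, then along the top row, where only the monic X^(d-j-1) A
  -- reaches the top degree. What remains is the Sylvester matrix of index j + 1.
  rw [e1, e2, detOf_succ_of_col (m := m + 1) (by omega)]
  · rw [detOf_succ_of_row_zero]
    · rw [principalSubres_eq_detOf, e3]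
      congr 1
      · rw [show d - j - 1 = m by omega, show m + m + 1 + (m + 1) = m + 2 * (m + 1) by ring,
          pow_add, pow_mul]
        simp
      · refine detOf_congr fun r hr c hc => ?_
        rw [show d + d - j - 1 - (r + 1) = d + d - (j + 1) - 1 - r by omega]
        unfold sylvesterColumn
        rw [hm, e3]
        by_cases hcm : c < m
        · simp only [show c + 1 < m + 1 by omega, hcm, if_true]
          rw [if_neg (by omega), show m + 1 - 1 - (c + 1) = m - 1 - c by omega]
        · simp only [show ¬ (c + 1 < m + 1) by omega, hcm, if_false]
          rw [if_neg (by omega), if_neg (by omega),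
            show m + 1 - 1 - (c + 1 + 1 - (m + 1)) = m - 1 - (c - m) by omega]
    · simp only [Nat.zero_lt_succ, if_true]
      rw [if_neg (by omega), sylvesterColumn, if_pos (by omega), hm,
        show d + d - j - 1 - 0 = d + (m + 1 - 1 - 0) by omega, coeff_X_pow_mul, ← hAd]
      exact hA
    · intro c hc
      unfold sylvesterColumn
      rw [hm]
      by_cases hcm : c < m
      · simp only [show c + 1 < m + 1 by omega, if_true]
        rw [if_neg (by omega)]
        exact hX A _ _ hAd.le (by omega)
      · simp only [show ¬ (c + 1 < m + 1) by omega, if_false]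
        rw [if_neg (by omega), if_neg (by omega)]
        exact hX B _ _ hB (by omega)
  · simp only [hm, if_true]
  · intro r hr
    simp only [hm, if_true]
    rw [if_neg (by omega)]

end SylvesterAlgebra

/-! ### Dependence of principal subresultants on the expansion of B / A at infinity. -/

section Invariance

variable {R : Type u} [CommRing R]

theorem natDegree_sylvesterColumn_le {d k c : ℕ} (hk : k < d) {A B : R[X]} (hA : A.natDegree ≤ d)
    (hB : B.natDegree ≤ d) : (sylvesterColumn d d k A B c).natDegree ≤ d + d - k - 1 := by
  unfold sylvesterColumn
  split_ifs
  · exact (natDegree_mul_le_of_le (natDegree_X_pow_le _) hA).trans (by omega)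
  · exact (natDegree_mul_le_of_le (natDegree_X_pow_le _) hB).trans (by omega)

/-- Multiplying both polynomials by a monic polynomial shifts the principal subresultants. -/
theorem principalSubres_monic_mul {d k m : ℕ} (hk : k ≤ d) {A B D : R[X]} (hA : A.natDegree ≤ d)
    (hB : B.natDegree ≤ d) (hD : D.Monic) (hDm : D.natDegree = m) :
    principalSubres (d + m) (d + m) (k + m) (D * A) (D * B) = principalSubres d d k A B := by
  rcases hk.eq_or_lt with rfl | hk
  · rw [principalSubres_self, principalSubres_self]
  set E := d + d - k - 1 with hE
  set K := (d - k) + (d - k) with hK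
  -- Multiplication by D seen on the top K coefficients: it is unitriangular because D is monic, so
  -- lower coefficients never feed into higher ones.
  let T : Matrix (Fin K) (Fin K) R := fun r s => (D * X ^ (E - s)).coeff (E - r + m)
  have hlt : ∀ r < K, ∀ s, r < s → s ≤ E → (D * X ^ (E - s)).coeff (E - r + m) = 0 := by
    intro r hr s hrs hs
    apply coeff_eq_zero_of_natDegree_lt
    refine lt_of_le_of_lt (natDegree_mul_le_of_le hDm.le (natDegree_X_pow_le _)) (by omega)
  have hT : T.det = 1 := by
    rw [Matrix.det_of_isLowerTriangular T]
    · refine Finset.prod_eq_one fun r _ => ?_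
      change (D * X ^ (E - r)).coeff (E - r + m) = 1
      rw [add_comm, coeff_mul_X_pow, ← hDm]
      exact hD
    · intro r s hrs
      have hrs' : r < s := hrs
      exact hlt r r.2 s hrs' (by have := s.2; omega)
  have hcol : ∀ c, sylvesterColumn (d + m) (d + m) (k + m) (D * A) (D * B) c =
      D * sylvesterColumn d d k A B c := by
    intro c
    unfold sylvesterColumn
    rw [Nat.add_sub_add_right]
    split_ifs <;> ring
  have hprod : T * sylvesterMatrix d d k A B = Matrix.of fun r c : Fin K =>
      (sylvesterColumn (d + m) (d + m) (k + m) (D * A) (D * B) c).coeff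
        (d + m + (d + m) - (k + m) - 1 - r) := by
    ext r c
    rw [Matrix.mul_apply, Matrix.of_apply, hcol,
      show d + m + (d + m) - (k + m) - 1 - (r : ℕ) = E - r + m by have := r.2; omega]
    have hdeg := natDegree_sylvesterColumn_le (c := c) hk hA hB
    rw [← hE] at hdeg
    conv_rhs => rw [as_sum_range_C_mul_X_pow' _ (Nat.lt_succ_of_le hdeg),
      ← Finset.sum_range_reflect, Finset.mul_sum, finsetSum_coeff]
    rw [← Finset.sum_subset (Finset.range_subset_range.2 (show K ≤ E.succ by omega)),
      Finset.sum_range]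
    · refine Finset.sum_congr rfl fun s _ => ?_
      rw [mul_left_comm, coeff_C_mul, mul_comm]
      rfl
    · intro s hs hs'
      rw [Finset.mem_range] at hs hs'
      rw [mul_left_comm, coeff_C_mul, Nat.succ_sub_one,
        hlt r r.2 s (by have := r.2; omega) (by omega), mul_zero]
  have hfin : principalSubres (d + m) (d + m) (k + m) (D * A) (D * B) =
      (T * sylvesterMatrix d d k A B).det := by
    rw [hprod, principalSubres_eq_detOf, Nat.add_sub_add_right]
    rfl
  rw [hfin, Matrix.det_mul, hT, one_mul]
  rfl

/-- The `k`-th principal subresultant of `(A, B)` with `A` monic only depends on `B / A` up to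
sufficient order at infinity. -/
theorem principalSubres_eq_of_natDegree_le {d k : ℕ} (hk : k ≤ d) {A B A' B' : R[X]}
    (hA : A.Monic) (hAd : A.natDegree = d) (hB : B.natDegree ≤ d) (hA' : A'.Monic)
    (hAd' : A'.natDegree = d) (hB' : B'.natDegree ≤ d)
    (h : (A * B' - A' * B).natDegree ≤ 2 * k) :
    principalSubres d d k A' B' = principalSubres d d k A B := by
  -- Compare (A A', A B') with (A' A, A' B). The first columns agree; the others differ by shifts,
  -- by at most d - k - 1, of a polynomial of degree at most 2k, while the rows only see degrees at
  -- least d + k.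
  rw [← principalSubres_monic_mul hk hAd'.le hB' hA hAd,
    ← principalSubres_monic_mul hk hAd.le hB hA' hAd', principalSubres_eq_detOf,
    principalSubres_eq_detOf]
  refine detOf_congr fun r hr c hc => ?_
  unfold sylvesterColumn
  split_ifs with hcd
  · rw [mul_comm A A']
  · rw [← sub_eq_zero, ← coeff_sub, ← mul_sub]
    apply coeff_eq_zero_of_natDegree_lt
    refine lt_of_le_of_lt (natDegree_mul_le_of_le (natDegree_X_pow_le _) h) (by omega)

end Invariance

/-! ### Compatibility with ring homomorphisms. -/

section Map

variable {R : Type u} {S : Type v} [CommRing R] [CommRing S] (f : R →+* S)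

theorem sylvesterMatrix_map (d k : ℕ) (A B : R[X]) :
    sylvesterMatrix d d k (A.map f) (B.map f) = f.mapMatrix (sylvesterMatrix d d k A B) := by
  ext r c
  simp only [sylvesterMatrix, RingHom.mapMatrix_apply, Matrix.map_apply, sylvesterColumn]
  rw [← coeff_map]
  split_ifs <;> simp

theorem principalSubres_map (d k : ℕ) (A B : R[X]) :
    principalSubres d d k (A.map f) (B.map f) = f (principalSubres d d k A B) := by
  rw [principalSubres, principalSubres, sylvesterMatrix_map, RingHom.map_det]

theorem cofactorCoords_map (d k : ℕ) (A B : R[X]) (c : Fin ((d - k) + (d - k))) :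
    cofactorCoords d d k (A.map f) (B.map f) c = f (cofactorCoords d d k A B c) := by
  rw [cofactorCoords, cofactorCoords, Matrix.cramer_apply, Matrix.cramer_apply, RingHom.map_det,
    sylvesterMatrix_map]
  congr 1
  ext r s
  simp only [RingHom.mapMatrix_apply, Matrix.map_apply, Matrix.updateCol_apply]
  split_ifs <;> simp

theorem subres_map (d k : ℕ) (A B : R[X]) :
    subres d d k (A.map f) (B.map f) = (subres d d k A B).map f := by
  simp only [subres, cofactorU, cofactorV, cofactorCoords_map, Polynomial.map_add,
    Polynomial.map_mul, Polynomial.map_sum]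
  congr 2
  · refine Finset.sum_congr rfl fun c _ => ?_
    split_ifs <;> simp
  · refine Finset.sum_congr rfl fun c _ => ?_
    split_ifs <;> simp

end Map

/-! ### The pseudo-remainder recurrence and the lifting of perturbations to the input. -/

section Recurrence

variable {R : Type u} [CommRing R]

/-- Two monic polynomials of degree `d`. -/
structure MonicPair (d : ℕ) (A B : R[X]) : Prop where
  monic_left : A.Monic
  natDegree_left : A.natDegree = d
  monic_right : B.Monic
  natDegree_right : B.natDegree = d

theorem MonicPair.coeff_left {d : ℕ} {A B : R[X]} (h : MonicPair d A B) : A.coeff d = 1 := by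
  rw [← h.natDegree_left]; exact h.monic_left

theorem MonicPair.coeff_right {d : ℕ} {A B : R[X]} (h : MonicPair d A B) : B.coeff d = 1 := by
  rw [← h.natDegree_right]; exact h.monic_right

theorem MonicPair.of_coeff [Nontrivial R] {d : ℕ} {A B : R[X]} (hA : A.natDegree ≤ d)
    (hA1 : A.coeff d = 1) (hB : B.natDegree ≤ d) (hB1 : B.coeff d = 1) : MonicPair d A B where
  monic_left := monic_of_natDegree_le_of_coeff_eq_one d hA hA1
  natDegree_left := natDegree_eq_of_le_of_coeff_ne_zero hA (by rw [hA1]; exact one_ne_zero)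
  monic_right := monic_of_natDegree_le_of_coeff_eq_one d hB hB1
  natDegree_right := natDegree_eq_of_le_of_coeff_ne_zero hB (by rw [hB1]; exact one_ne_zero)

/-- The cofactor of `A` in the `k`-th subresultant, extended by `0` for `k = d`. -/
noncomputable def extU (d k : ℕ) (A B : R[X]) : R[X] :=
  if k < d then cofactorU d d k A B else 0

/-- The cofactor of `B` in the `k`-th subresultant, extended by `1` for `k = d`. -/
noncomputable def extV (d k : ℕ) (A B : R[X]) : R[X] :=
  if k < d then cofactorV d d k A B else 1

/-- The `k`-th subresultant, extended by `B` for `k = d`. -/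
noncomputable def extSubres (d k : ℕ) (A B : R[X]) : R[X] :=
  A * extU d k A B + B * extV d k A B

theorem extSubres_of_lt {d k : ℕ} (hk : k < d) (A B : R[X]) :
    extSubres d k A B = subres d d k A B := by
  rw [extSubres, extU, extV, if_pos hk, if_pos hk, subres]

theorem extSubres_self (d : ℕ) (A B : R[X]) : extSubres d d A B = B := by
  rw [extSubres, extU, extV, if_neg (lt_irrefl d), if_neg (lt_irrefl d), mul_zero, zero_add,
    mul_one]

theorem natDegree_extU_le (d k : ℕ) (A B : R[X]) : (extU d k A B).natDegree ≤ d - k - 1 := by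
  unfold extU
  split_ifs
  · exact natDegree_cofactorU_le _ _ _ _
  · rw [natDegree_zero]; exact Nat.zero_le _

theorem natDegree_extV_le (d k : ℕ) (A B : R[X]) : (extV d k A B).natDegree ≤ d - k - 1 := by
  unfold extV
  split_ifs
  · exact natDegree_cofactorV_le _ _ _ _
  · rw [natDegree_one]; exact Nat.zero_le _

/-- At k = d the empty determinant 1 matches the leading coefficient of the monic B, so the
convention R_d = B is consistent. -/
theorem coeff_extSubres {d k : ℕ} (hk : k ≤ d) {A B : R[X]} (h : MonicPair d A B) {i : ℕ}
    (hi : k ≤ i) :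
    (extSubres d k A B).coeff i = if i = k then principalSubres d d k A B else 0 := by
  rcases hk.eq_or_lt with rfl | hk
  · rw [extSubres_self, principalSubres_self]
    split_ifs with hik
    · rw [hik, h.coeff_right]
    · exact coeff_eq_zero_of_natDegree_lt (by have := h.natDegree_right; omega)
  · rw [extSubres_of_lt hk]
    exact coeff_subres hk h.natDegree_left.le h.natDegree_right.le hi

theorem coeff_extSubres_self {d k : ℕ} (hk : k ≤ d) {A B : R[X]} (h : MonicPair d A B) :
    (extSubres d k A B).coeff k = principalSubres d d k A B := by
  rw [coeff_extSubres hk h le_rfl, if_pos rfl]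

theorem natDegree_extSubres_le {d k : ℕ} (hk : k ≤ d) {A B : R[X]} (h : MonicPair d A B) :
    (extSubres d k A B).natDegree ≤ k := by
  rw [natDegree_le_iff_coeff_eq_zero]
  intro i hi
  rw [coeff_extSubres hk h hi.le, if_neg hi.ne']

theorem coeff_extV {d j : ℕ} (hj : j < d) {A B : R[X]} (h : MonicPair d A B) :
    (extV d j A B).coeff (d - j - 1) =
      (-1) ^ (d - j - 1) * principalSubres d d (j + 1) A B := by
  rw [extV, if_pos hj]
  exact coeff_cofactorV hj h.monic_left h.natDegree_left h.natDegree_right.le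

theorem coeff_add_of_coeff_eq_zero {d n : ℕ} {A B U V : R[X]} (h : MonicPair d A B)
    (hU : U.natDegree ≤ n) (hV : V.natDegree ≤ n) (h0 : (A * U + B * V).coeff (d + n) = 0) :
    U.coeff n = -V.coeff n := by
  rw [coeff_add, coeff_mul_add_eq_of_natDegree_le h.natDegree_left.le hU,
    coeff_mul_add_eq_of_natDegree_le h.natDegree_right.le hV, h.coeff_left, h.coeff_right, one_mul,
    one_mul] at h0
  exact eq_neg_of_add_eq_zero_left h0

theorem coeff_extU {d j : ℕ} (hj : j < d) {A B : R[X]} (h : MonicPair d A B) :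
    (extU d j A B).coeff (d - j - 1) =
      -((-1) ^ (d - j - 1) * principalSubres d d (j + 1) A B) := by
  rw [← coeff_extV hj h]
  refine coeff_add_of_coeff_eq_zero h (natDegree_extU_le _ _ _ _) (natDegree_extV_le _ _ _ _) ?_
  change (extSubres d j A B).coeff _ = 0
  rw [coeff_extSubres hj.le h (by omega), if_neg (by omega)]

/-- Here both cofactors are constants, so their leading coefficients -1 and 1 determine them. -/
theorem extSubres_pred {d : ℕ} (hd : 0 < d) {A B : R[X]} (h : MonicPair d A B) :
    extSubres d (d - 1) A B = B - A := by
  have hU := coeff_extU (j := d - 1) (by omega) h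
  have hV := coeff_extV (j := d - 1) (by omega) h
  rw [show d - (d - 1) - 1 = 0 by omega, show d - 1 + 1 = d by omega, principalSubres_self,
    pow_zero, one_mul] at hU hV
  have hU' := natDegree_extU_le d (d - 1) A B
  have hV' := natDegree_extV_le d (d - 1) A B
  rw [show d - (d - 1) - 1 = 0 by omega] at hU' hV'
  rw [extSubres, eq_C_of_natDegree_le_zero hU', eq_C_of_natDegree_le_zero hV', hU, hV]
  simp only [map_neg, map_one]
  ring

/-- The determinant of two consecutive pairs of cofactors. -/
theorem extU_mul_extV_sub {d j : ℕ} (hj : j < d) {A B : R[X]} (h : MonicPair d A B) :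
    extU d (j + 1) A B * extV d j A B - extU d j A B * extV d (j + 1) A B =
      C ((-1) ^ (d - j - 1) * principalSubres d d (j + 1) A B ^ 2) := by
  set D := extU d (j + 1) A B * extV d j A B - extU d j A B * extV d (j + 1) A B with hD
  -- Multiplying by the monic A brings in subresultants of small degree: the product has degree at
  -- most d, so D is constant, and its value is read off in degree d.
  have e : A * D = extSubres d (j + 1) A B * extV d j A B -
      extSubres d j A B * extV d (j + 1) A B := by
    rw [hD, extSubres, extSubres]; ring
  have h1 : (extSubres d (j + 1) A B * extV d j A B).natDegree ≤ d :=
    (natDegree_mul_le_of_le (natDegree_extSubres_le hj h) (natDegree_extV_le _ _ _ _)).trans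
      (by omega)
  have h2 : (extSubres d j A B * extV d (j + 1) A B).natDegree < d :=
    lt_of_le_of_lt (natDegree_mul_le_of_le (natDegree_extSubres_le hj.le h)
      (natDegree_extV_le _ _ _ _)) (by omega)
  have h3 : (A * D).natDegree ≤ d := by
    rw [e]
    exact (natDegree_sub_le _ _).trans (max_le h1 h2.le)
  have h4 : D.natDegree ≤ 0 := by
    by_cases hD0 : D = 0
    · rw [hD0, natDegree_zero]
    · rw [h.monic_left.natDegree_mul' hD0, h.natDegree_left] at h3
      omega
  rw [eq_C_of_natDegree_le_zero h4]
  congr 1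
  have h5 : (A * D).coeff (d + 0) = D.coeff 0 := by
    rw [coeff_mul_add_eq_of_natDegree_le h.natDegree_left.le h4, h.coeff_left, one_mul]
  have h6 : (extSubres d (j + 1) A B * extV d j A B).coeff d =
      (extSubres d (j + 1) A B).coeff (j + 1) * (extV d j A B).coeff (d - j - 1) := by
    rw [← coeff_mul_add_eq_of_natDegree_le (natDegree_extSubres_le hj h) (natDegree_extV_le _ _ _ _)]
    congr 1; omega
  rw [← h5, e, add_zero, coeff_sub, coeff_eq_zero_of_natDegree_lt h2, sub_zero, h6, coeff_extSubres_self hj h, coeff_extV hj h]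
  ring

theorem coeff_C_mul_X_add_C_mul (a s : R) (P : R[X]) (i : ℕ) :
    ((C a * X + C s) * P).coeff (i + 1) = a * P.coeff i + s * P.coeff (i + 1) := by
  rw [add_mul, coeff_add, coeff_C_mul, mul_assoc, coeff_C_mul, coeff_X_mul]

variable [IsDomain R]

theorem extUV_unique {d k : ℕ} (hk : k ≤ d) {A B U V : R[X]} (h : MonicPair d A B)
    (hr : principalSubres d d k A B ≠ 0) (hU : ∀ i, d - k ≤ i → U.coeff i = 0)
    (hV : ∀ i, d - k ≤ i → V.coeff i = 0)
    (hUV : ∀ i, k ≤ i → (A * U + B * V).coeff i = if i = k then principalSubres d d k A B else 0)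
    (hkd : k < d) : U = extU d k A B ∧ V = extV d k A B := by
  have key := eq_zero_of_principalSubres_ne_zero (U := U - extU d k A B)
    (V := V - extV d k A B) hk hr
    (fun i hi => by
      rw [coeff_sub, hU i hi, coeff_eq_zero_of_natDegree_lt, sub_zero]
      exact lt_of_le_of_lt (natDegree_extU_le _ _ _ _) (by omega))
    (fun i hi => by
      rw [coeff_sub, hV i hi, coeff_eq_zero_of_natDegree_lt, sub_zero]
      exact lt_of_le_of_lt (natDegree_extV_le _ _ _ _) (by omega))
    (fun i hi => by
      rw [show A * (U - extU d k A B) + B * (V - extV d k A B) =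
        (A * U + B * V) - extSubres d k A B by rw [extSubres]; ring, coeff_sub, hUV i hi,
        coeff_extSubres hk h hi, sub_self])
  exact ⟨sub_eq_zero.1 key.1, sub_eq_zero.1 key.2⟩

/-- The cofactors of index `j` are characterized by the leading coefficient of the second one when
the principal subresultant of index `j + 1` does not vanish. -/
theorem eq_mul_extUV {d j : ℕ} (hj : j < d) {A B U V : R[X]} (h : MonicPair d A B) {c : R}
    (hr : principalSubres d d (j + 1) A B ≠ 0) (hU : U.natDegree ≤ d - j - 1)
    (hV : V.natDegree ≤ d - j - 1) (hUV : (A * U + B * V).natDegree ≤ j)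
    (hc : V.coeff (d - j - 1) =
      (-1) ^ (d - j - 1) * (c * principalSubres d d (j + 1) A B)) :
    U = C c * extU d j A B ∧ V = C c * extV d j A B := by
  have hUc : U.coeff (d - j - 1) = -V.coeff (d - j - 1) :=
    coeff_add_of_coeff_eq_zero h hU hV (coeff_eq_zero_of_natDegree_lt (by omega))
  -- Subtraction kills the top coefficients, so the difference lies in the domain of the Sylvester
  -- map of index j + 1. Only r_{j+1} has to be nonzero; r_j may vanish.
  have key := eq_zero_of_principalSubres_ne_zero (U := U - C c * extU d j A B)
    (V := V - C c * extV d j A B) hj hr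
    (fun i hi => by
      rcases (show d - j - 1 ≤ i by omega).eq_or_lt with rfl | hi'
      · rw [coeff_sub, coeff_C_mul, coeff_extU hj h, hUc, hc]; ring
      · rw [coeff_sub, coeff_C_mul, coeff_eq_zero_of_natDegree_lt (by omega),
          coeff_eq_zero_of_natDegree_lt (lt_of_le_of_lt (natDegree_extU_le _ _ _ _) hi'),
          mul_zero, sub_zero])
    (fun i hi => by
      rcases (show d - j - 1 ≤ i by omega).eq_or_lt with rfl | hi'
      · rw [coeff_sub, coeff_C_mul, coeff_extV hj h, hc]; ring
      · rw [coeff_sub, coeff_C_mul, coeff_eq_zero_of_natDegree_lt (by omega),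
          coeff_eq_zero_of_natDegree_lt (lt_of_le_of_lt (natDegree_extV_le _ _ _ _) hi'),
          mul_zero, sub_zero])
    (fun i hi => by
      rw [show A * (U - C c * extU d j A B) + B * (V - C c * extV d j A B) =
        (A * U + B * V) - C c * extSubres d j A B by rw [extSubres]; ring, coeff_sub,
        coeff_C_mul, coeff_eq_zero_of_natDegree_lt (by omega), coeff_eq_zero_of_natDegree_lt
          (lt_of_le_of_lt (natDegree_extSubres_le hj.le h) (by omega)), mul_zero, sub_zero])
  exact ⟨sub_eq_zero.1 key.1, sub_eq_zero.1 key.2⟩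

/-- The subresultant pseudo-remainder recurrence. -/
theorem extSubres_recurrence {d j : ℕ} (hj : j + 1 < d) {A B : R[X]} (h : MonicPair d A B)
    (hr : principalSubres d d (j + 1) A B ≠ 0) (r₁ r₂ s : R)
    (hr₁ : r₁ = (extSubres d (j + 1) A B).coeff (j + 1))
    (hr₂ : r₂ = (extSubres d (j + 2) A B).coeff (j + 2))
    (hs : s = r₁ * (extSubres d (j + 2) A B).coeff (j + 1) -
      r₂ * (extSubres d (j + 1) A B).coeff j) :
    C (r₂ ^ 2) * extSubres d j A B = C (r₁ ^ 2) * extSubres d (j + 2) A B -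
      (C (r₁ * r₂) * X + C s) * extSubres d (j + 1) A B := by
  have hr₁' := coeff_extSubres_self hj.le h
  have hr₂' := coeff_extSubres_self (show j + 2 ≤ d from hj) h
  rw [← hr₁] at hr₁'
  rw [← hr₂] at hr₂'
  have hlin : (C (r₁ * r₂) * X + C s).natDegree ≤ 1 := natDegree_linear_le
  set U := C (r₁ ^ 2) * extU d (j + 2) A B - (C (r₁ * r₂) * X + C s) * extU d (j + 1) A B
    with hU
  set V := C (r₁ ^ 2) * extV d (j + 2) A B - (C (r₁ * r₂) * X + C s) * extV d (j + 1) A B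
    with hV
  have e : A * U + B * V = C (r₁ ^ 2) * extSubres d (j + 2) A B -
      (C (r₁ * r₂) * X + C s) * extSubres d (j + 1) A B := by
    rw [hU, hV, extSubres, extSubres]; ring
  -- The factor r₂ ^ 2 comes from the leading coefficient of V: the term in X contributes r₁ * r₂
  -- times the leading coefficient of the cofactor of index j + 1, which is r₂ up to sign.
  have key := eq_mul_extUV (U := U) (V := V) (c := r₂ ^ 2) (by omega : j < d) h hr ?_ ?_ ?_ ?_
  · rw [← e, key.1, key.2, extSubres]; ring
  · refine (natDegree_sub_le _ _).trans (max_le ?_ ?_)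
    · exact (natDegree_C_mul_le _ _).trans ((natDegree_extU_le _ _ _ _).trans (by omega))
    · exact (natDegree_mul_le_of_le hlin (natDegree_extU_le _ _ _ _)).trans (by omega)
  · refine (natDegree_sub_le _ _).trans (max_le ?_ ?_)
    · exact (natDegree_C_mul_le _ _).trans ((natDegree_extV_le _ _ _ _).trans (by omega))
    · exact (natDegree_mul_le_of_le hlin (natDegree_extV_le _ _ _ _)).trans (by omega)
  · rw [e, natDegree_le_iff_coeff_eq_zero]
    intro i hi
    obtain ⟨i, rfl⟩ : ∃ i', i = i' + 1 := ⟨i - 1, by omega⟩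
    rw [coeff_sub, coeff_C_mul, coeff_C_mul_X_add_C_mul]
    rcases (show j ≤ i by omega).eq_or_lt with rfl | hi1
    · rw [hs, ← hr₁]; ring
    · rcases (show j + 1 ≤ i by omega).eq_or_lt with rfl | hi2
      · rw [coeff_extSubres (k := j + 1) hj.le h (i := j + 1 + 1) (by omega), if_neg (by omega),
          ← hr₁, show j + 1 + 1 = j + 2 by rfl, ← hr₂]
        ring
      · rw [coeff_extSubres (k := j + 2) hj h (by omega), if_neg (by omega),
          coeff_extSubres (k := j + 1) hj.le h (by omega), if_neg (by omega),
          coeff_extSubres (k := j + 1) hj.le h (by omega), if_neg (by omega)]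
        ring
  · rw [hV, coeff_sub, coeff_C_mul, coeff_eq_zero_of_natDegree_lt
      (lt_of_le_of_lt (natDegree_extV_le d (j + 2) A B) (by omega)),
      show d - j - 1 = (d - (j + 1) - 1) + 1 by omega, coeff_C_mul_X_add_C_mul,
      coeff_extV hj h, coeff_eq_zero_of_natDegree_lt
      (lt_of_le_of_lt (natDegree_extV_le d (j + 1) A B) (Nat.lt_succ_self _)), hr₁',
      show j + 1 + 1 = j + 2 by rfl, hr₂']
    ring

/-- A perturbation of two consecutive subresultants, of size `p` times the square of the
leading coefficient of the first one, comes, up to a scalar, from a perturbation of size `p` of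
the polynomials. -/
theorem exists_lift {d j : ℕ} (hj : j < d) {A B : R[X]} (h : MonicPair d A B)
    (hr : principalSubres d d (j + 1) A B ≠ 0) (p u : R) (u₁ : Rˣ) (e₁ e₀ : R[X])
    (he₁ : e₁.natDegree ≤ j + 1) (he₀ : e₀.natDegree ≤ j)
    (hu₁ : (u₁ : R) = u + p * principalSubres d d (j + 1) A B * e₁.coeff (j + 1)) :
    ∃ A' B' a b : R[X], MonicPair d A' B' ∧ A' = A + C p * a ∧ B' = B + C p * b ∧
      C u * extSubres d (j + 1) A B + C (p * principalSubres d d (j + 1) A B ^ 2) * e₁ =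
        C (u₁ : R) * extSubres d (j + 1) A' B' ∧
      C u * extSubres d j A B + C (p * principalSubres d d (j + 1) A B ^ 2) * e₀ =
        C (u₁ : R) * extSubres d j A' B' := by
  set r := principalSubres d d (j + 1) A B with hrdef
  obtain ⟨ε, hε⟩ : ∃ ε : R, ε = (-1) ^ (d - j - 1) := ⟨_, rfl⟩
  have hεε : ε * ε = 1 := by rw [hε, ← mul_pow]; simp
  have hεC : (C ε * C ε : R[X]) = 1 := by rw [← C_mul, hεε, C_1]
  set U₁ := extU d (j + 1) A B with hU₁
  set V₁ := extV d (j + 1) A B with hV₁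
  set U₀ := extU d j A B with hU₀
  set V₀ := extV d j A B with hV₀
  have dU₁ : U₁.natDegree ≤ d - (j + 1) - 1 := natDegree_extU_le _ _ _ _
  have dV₁ : V₁.natDegree ≤ d - (j + 1) - 1 := natDegree_extV_le _ _ _ _
  have dU₀ : U₀.natDegree ≤ d - j - 1 := natDegree_extU_le _ _ _ _
  have dV₀ : V₀.natDegree ≤ d - j - 1 := natDegree_extV_le _ _ _ _
  have cV₀ : V₀.coeff (d - j - 1) = ε * r := by rw [hε]; exact coeff_extV hj h
  have cU₀ : U₀.coeff (d - j - 1) = -(ε * r) := by rw [hε]; exact coeff_extU hj h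
  have hdet : U₁ * V₀ - U₀ * V₁ = C ε * C r ^ 2 := by
    rw [hU₁, hV₀, hU₀, hV₁, extU_mul_extV_sub hj h, ← C_pow, ← C_mul, hε]
  set w : R := ((u₁⁻¹ : Rˣ) : R) with hw
  have hwu : w * u₁ = 1 := by rw [hw, ← Units.val_mul, inv_mul_cancel, Units.val_one]
  have hwuC : (C w * C (u₁ : R) : R[X]) = 1 := by rw [← C_mul, hwu, C_1]
  -- Solution of the linear system with the cofactors U₁, V₁, U₀, V₀ kept as coefficients: the
  -- adjugate is applied to the errors, and the determinant ε r² cancels the r² in their size. The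
  -- factor w restores monicity.
  set A' := C w * (C u * A + C ε * C p * (V₀ * e₁ - V₁ * e₀)) with hA'
  set B' := C w * (C u * B + C ε * C p * (U₁ * e₀ - U₀ * e₁)) with hB'
  have deg_aux : ∀ X₀ X₁ : R[X], X₀.natDegree ≤ d - j - 1 → X₁.natDegree ≤ d - (j + 1) - 1 →
      (X₀ * e₁).natDegree ≤ d ∧ (X₁ * e₀).natDegree < d ∧
      (X₀ * e₁).coeff d = X₀.coeff (d - j - 1) * e₁.coeff (j + 1) := by
    intro X₀ X₁ h₀ h₁
    refine ⟨(natDegree_mul_le_of_le h₀ he₁).trans (by omega),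
      lt_of_le_of_lt (natDegree_mul_le_of_le h₁ he₀) (by omega), ?_⟩
    rw [← coeff_mul_add_eq_of_natDegree_le h₀ he₁]
    congr 1; omega
  obtain ⟨v1, v2, v3⟩ := deg_aux V₀ V₁ dV₀ dV₁
  obtain ⟨t1, t2, t3⟩ := deg_aux U₀ U₁ dU₀ dU₁
  have hpair : MonicPair d A' B' := by
    refine MonicPair.of_coeff ?_ ?_ ?_ ?_
    · refine (natDegree_C_mul_le _ _).trans ((natDegree_add_le _ _).trans (max_le
        ((natDegree_C_mul_le _ _).trans h.natDegree_left.le) ?_))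
      rw [← C_mul]
      exact (natDegree_C_mul_le _ _).trans ((natDegree_sub_le _ _).trans (max_le v1 v2.le))
    · rw [hA', ← C_mul, coeff_C_mul, coeff_add, coeff_C_mul, coeff_C_mul, coeff_sub, v3,
        coeff_eq_zero_of_natDegree_lt v2, cV₀, h.coeff_left]
      linear_combination hwu - w * hu₁ + (w * p * r * e₁.coeff (j + 1)) * hεε
    · refine (natDegree_C_mul_le _ _).trans ((natDegree_add_le _ _).trans (max_le
        ((natDegree_C_mul_le _ _).trans h.natDegree_right.le) ?_))
      rw [← C_mul]
      exact (natDegree_C_mul_le _ _).trans ((natDegree_sub_le _ _).trans (max_le t2.le t1))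
    · rw [hB', ← C_mul, coeff_C_mul, coeff_add, coeff_C_mul, coeff_C_mul, coeff_sub, t3,
        coeff_eq_zero_of_natDegree_lt t2, cU₀, h.coeff_right]
      linear_combination hwu - w * hu₁ + (w * p * r * e₁.coeff (j + 1)) * hεε
  have hR₁ : extSubres d (j + 1) A B = A * U₁ + B * V₁ := rfl
  have hR₀ : extSubres d j A B = A * U₀ + B * V₀ := rfl
  have hX₁ : C (u₁ : R) * (A' * U₁ + B' * V₁) =
      C u * extSubres d (j + 1) A B + C (p * r ^ 2) * e₁ := by
    rw [hA', hB', hR₁, C_mul, C_pow]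
    linear_combination (C u * (A * U₁ + B * V₁) + C ε * C p * e₁ * (U₁ * V₀ - U₀ * V₁)) * hwuC +
      (C ε * C p * e₁) * hdet + (C p * C r ^ 2 * e₁) * hεC
  have hX₀ : C (u₁ : R) * (A' * U₀ + B' * V₀) =
      C u * extSubres d j A B + C (p * r ^ 2) * e₀ := by
    rw [hA', hB', hR₀, C_mul, C_pow]
    linear_combination (C u * (A * U₀ + B * V₀) + C ε * C p * e₀ * (U₁ * V₀ - U₀ * V₁)) * hwuC +
      (C ε * C p * e₀) * hdet + (C p * C r ^ 2 * e₀) * hεC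
  -- This has degree at most 2 (j + 1), so the principal subresultant of index j + 1 does not
  -- change.
  have hcross : A * B' - A' * B = C (w * ε * p) *
      (e₀ * extSubres d (j + 1) A B - e₁ * extSubres d j A B) := by
    rw [hA', hB', hR₀, hR₁, C_mul, C_mul]; ring
  have dR₁ := natDegree_extSubres_le hj h
  have dR₀ := natDegree_extSubres_le hj.le h
  have hr' : principalSubres d d (j + 1) A' B' = r := by
    refine principalSubres_eq_of_natDegree_le hj h.monic_left h.natDegree_left
      h.natDegree_right.le hpair.monic_left hpair.natDegree_left hpair.natDegree_right.le ?_
    rw [hcross]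
    refine (natDegree_C_mul_le _ _).trans ((natDegree_sub_le _ _).trans (max_le ?_ ?_))
    · exact (natDegree_mul_le_of_le he₀ dR₁).trans (by omega)
    · exact (natDegree_mul_le_of_le he₁ dR₀).trans (by omega)
  have hdX₀ : (A' * U₀ + B' * V₀).natDegree ≤ j := by
    have : A' * U₀ + B' * V₀ = C w * (C u * extSubres d j A B + C (p * r ^ 2) * e₀) := by
      rw [← hX₀, ← mul_assoc, hwuC, one_mul]
    rw [this]
    exact (natDegree_C_mul_le _ _).trans ((natDegree_add_le _ _).trans (max_le
      ((natDegree_C_mul_le _ _).trans dR₀) ((natDegree_C_mul_le _ _).trans he₀)))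
  -- The old cofactors are those of the new pair: for index j by the leading coefficient, for index
  -- j + 1 by convention when j + 1 = d and by injectivity otherwise.
  have hcof₀ := eq_mul_extUV (U := U₀) (V := V₀) (c := 1) hj hpair (by rw [hr']; exact hr)
    dU₀ dV₀ hdX₀ (by rw [hr', one_mul, cV₀, hε])
  have hcof₁ : U₁ = extU d (j + 1) A' B' ∧ V₁ = extV d (j + 1) A' B' := by
    rcases (show j + 1 ≤ d from hj).eq_or_lt with hjd | hjd
    · rw [hU₁, hV₁]
      simp only [extU, extV, hjd, lt_irrefl, if_false, and_self]
    · refine extUV_unique hj hpair (by rw [hr']; exact hr)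
        (fun i hi => coeff_eq_zero_of_natDegree_lt (by omega))
        (fun i hi => coeff_eq_zero_of_natDegree_lt (by omega)) (fun i hi => ?_) hjd
      have e : A' * U₁ + B' * V₁ =
          C w * (C u * extSubres d (j + 1) A B + C (p * r ^ 2) * e₁) := by
        rw [← hX₁, ← mul_assoc, hwuC, one_mul]
      rw [e, coeff_C_mul, coeff_add, coeff_C_mul, coeff_C_mul, coeff_extSubres hj h hi, hr']
      split_ifs with hi'
      · rw [hi']
        linear_combination r * hwu - w * r * hu₁
      · rw [coeff_eq_zero_of_natDegree_lt (by omega)]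
        ring
  -- The last term accounts for the normalization: u and u₁ differ by a multiple of p.
  refine ⟨A', B', C w * (C ε * (V₀ * e₁ - V₁ * e₀) - C (r * e₁.coeff (j + 1)) * A),
    C w * (C ε * (U₁ * e₀ - U₀ * e₁) - C (r * e₁.coeff (j + 1)) * B), hpair, ?_, ?_, ?_, ?_⟩
  · have hu : (C (u₁ : R) : R[X]) = C u + C p * C (r * e₁.coeff (j + 1)) := by
      rw [hu₁, C_add, ← C_mul, mul_assoc]
    rw [hA']
    linear_combination A * hwuC - C w * A * hu
  · have hu : (C (u₁ : R) : R[X]) = C u + C p * C (r * e₁.coeff (j + 1)) := by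
      rw [hu₁, C_add, ← C_mul, mul_assoc]
    rw [hB']
    linear_combination B * hwuC - C w * B * hu
  · rw [← hX₁, hcof₁.1, hcof₁.2, ← extSubres]
  · rw [C_1, one_mul, one_mul] at hcof₀
    rw [← hX₀, hcof₀.1, hcof₀.2, ← extSubres]

end Recurrence

/-! ### Operation counts. -/

namespace Run

/-- `x` executes at most `L` primitive operations, at precisions at most `K`, and then behaves as
`y`. -/
def Reaches {α : Type u} (x y : Run α) (K L : ℕ) : Prop :=
  ∃ l : List ℕ, x = ⟨y.result, l ++ y.log⟩ ∧ l.length ≤ L ∧ ∀ k ∈ l, k ≤ K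

variable {α : Type u} {β : Type v}

theorem Reaches.refl (x : Run α) (K : ℕ) : Reaches x x K 0 :=
  ⟨[], rfl, le_rfl, fun _ h => absurd h List.not_mem_nil⟩

theorem Reaches.trans {x y z : Run α} {K L L' : ℕ} (h : Reaches x y K L) (h' : Reaches y z K L') :
    Reaches x z K (L + L') := by
  obtain ⟨l, rfl, hl, hk⟩ := h
  obtain ⟨l', rfl, hl', hk'⟩ := h'
  refine ⟨l ++ l', by rw [List.append_assoc], ?_, fun k hk0 => ?_⟩
  · rw [List.length_append]; exact Nat.add_le_add hl hl'
  · rcases List.mem_append.1 hk0 with h | h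
    · exact hk k h
    · exact hk' k h

theorem Reaches.mono {x y : Run α} {K L K' L' : ℕ} (h : Reaches x y K L) (hK : K ≤ K')
    (hL : L ≤ L') : Reaches x y K' L' := by
  obtain ⟨l, e, hl, hk⟩ := h
  exact ⟨l, e, hl.trans hL, fun k h => (hk k h).trans hK⟩

theorem Reaches.bind {x : Run α} {a : α} {K L : ℕ} (h : Reaches x (ret a) K L)
    (f : α → Run β) : Reaches (x.bind f) (f a) K L := by
  obtain ⟨l, rfl, hl, hk⟩ := h
  exact ⟨l, by simp [Run.bind, ret], hl, hk⟩

theorem Reaches.bind_trans {x : Run α} {a : α} {K L L' : ℕ} (h : Reaches x (ret a) K L)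
    {f : α → Run β} {y : Run β} (h' : Reaches (f a) y K L') :
    Reaches (x.bind f) y K (L + L') :=
  (h.bind f).trans h'

theorem Reaches.result_eq {x y : Run α} {K L : ℕ} (h : Reaches x y K L) :
    x.result = y.result := by
  obtain ⟨l, rfl, -, -⟩ := h
  rfl

theorem reaches_tick (n : ℕ) (a : α) : Reaches (tick n a) (ret a) n 1 :=
  ⟨[n], rfl, le_rfl, fun _ h => (List.mem_singleton.1 h).le⟩

theorem reaches_forEach [Zero α] {k : ℕ} {f : ℕ → Run α} {g : ℕ → α} {K L : ℕ}
    (h : ∀ i < k, Reaches (f i) (ret (g i)) K L) :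
    Reaches (forEach k f) (ret fun i => if i < k then g i else 0) K (k * L) := by
  induction k with
  | zero =>
    rw [Nat.zero_mul]
    simp only [Nat.not_lt_zero, if_false]
    exact Reaches.refl _ _
  | succ k ih =>
    rw [Nat.succ_mul, ← Nat.add_zero (k * L + L), Nat.add_assoc]
    refine (ih fun i hi => h i (by omega)).bind_trans ((h k (by omega)).bind_trans ?_)
    have : Function.update (fun i => if i < k then g i else 0) k (g k) =
        fun i => if i < k + 1 then g i else 0 := by
      funext i
      rw [Function.update_apply]
      split_ifs with h1 h2 h3 h4 h5
      · rw [h1]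
      · omega
      · rfl
      · omega
      · omega
      · rfl
    rw [this]
    exact Reaches.refl _ _

theorem Reaches.bitCost_le {x : Run α} {a : α} {K L : ℕ} (h : Reaches x (ret a) K L) {M : ℕ → ℕ}
    (hM : Monotone M) : x.bitCost M ≤ L * M K := by
  obtain ⟨l, rfl, hl, hk⟩ := h
  unfold bitCost
  simp only [ret, List.append_nil]
  refine (List.sum_le_card_nsmul (l.map M) (M K) ?_).trans ?_
  · intro y hy
    obtain ⟨k, hk', rfl⟩ := List.mem_map.1 hy
    exact hM (hk k hk')
  · rw [List.length_map, smul_eq_mul]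
    exact Nat.mul_le_mul_right _ hl

end Run

open Run

/-! ### Symbolic execution of the primitives and of one iteration. -/

section Approximations

variable {W : Type u} [CommRing W] {π : W}

theorem approx_eq_approx_iff {n : ℕ} {a b : W} :
    approx π n a = approx π n b ↔ π ^ n ∣ a - b := by
  rw [Ideal.Quotient.eq, Ideal.mem_span_singleton]

theorem reaches_mul {n : ℕ} (a b : Approx π n) : Reaches (mul a b) (ret (a * b)) n 1 :=
  reaches_tick _ _

theorem reaches_sub {n : ℕ} (a b : Approx π n) : Reaches (sub a b) (ret (a - b)) n 1 :=
  reaches_tick _ _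

/-- Cancelling π^w from a congruence modulo π^(n+w) leaves one modulo π^n, so the choice of quotient
does not matter. -/
theorem reaches_quo [IsDomain W] {n w : ℕ} (hπ : π ≠ 0) {q b : W} {ε : Wˣ}
    (hb : b = ε * π ^ w) :
    Reaches (quo (n := n) (w := w) (approx π (n + w) (q * b)) (approx π (n + w) b))
      (ret (approx π n q)) (n + w) 1 := by
  have h : ∃ q' : W, approx π (n + w) q' * approx π (n + w) b = approx π (n + w) (q * b) :=
    ⟨q, (map_mul _ _ _).symm⟩
  have hq : approx π n (Classical.choose h) = approx π n q := by
    have hs := Classical.choose_spec h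
    generalize Classical.choose h = q' at hs
    rw [← map_mul, approx_eq_approx_iff, ← sub_mul, hb, pow_add, mul_comm (ε : W), ← mul_assoc,
      Units.dvd_mul_right] at hs
    rw [approx_eq_approx_iff]
    exact (mul_dvd_mul_iff_right (pow_ne_zero w hπ)).1 hs
  unfold quo
  rw [dif_pos h, hq]
  exact reaches_tick _ _

/-- The value returned by `valuation`. -/
noncomputable def valuationValue {n : ℕ} (a : Approx π n) : ℕ :=
  open Classical in Nat.findGreatest (fun k => approx π n π ^ k ∣ a) n

theorem reaches_valuation {n : ℕ} (a : Approx π n) :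
    Reaches (valuation a) (ret (valuationValue a)) n 1 := reaches_tick _ _

theorem approx_pow_dvd_iff {n k : ℕ} (hk : k ≤ n) {x : W} :
    approx π n π ^ k ∣ approx π n x ↔ π ^ k ∣ x := by
  constructor
  · rintro ⟨y, hy⟩
    obtain ⟨y, rfl⟩ := Ideal.Quotient.mk_surjective y
    rw [← map_pow, ← map_mul, approx_eq_approx_iff] at hy
    rw [← dvd_sub_left (dvd_mul_right (π ^ k) y)]
    exact (pow_dvd_pow π hk).trans hy
  · rintro ⟨y, rfl⟩
    rw [map_mul, map_pow]
    exact dvd_mul_right _ _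

theorem le_valuationValue {n k : ℕ} (hk : k ≤ n) {x : W} (h : π ^ k ∣ x) :
    k ≤ valuationValue (approx π n x) := by
  classical
  unfold valuationValue
  exact Nat.le_findGreatest hk ((approx_pow_dvd_iff hk).2 h)

theorem valuationValue_eq [IsDomain W] (hπ : Irreducible π) {n v : ℕ} (hv : v ≤ n) {ε : Wˣ} :
    valuationValue (approx π n (ε * π ^ v)) = v := by
  classical
  refine le_antisymm ?_ (le_valuationValue hv (dvd_mul_left _ _))
  by_contra hlt
  rw [not_le] at hlt
  have hle : valuationValue (approx π n ((ε : W) * π ^ v)) ≤ n := Nat.findGreatest_le _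
  have hd : approx π n π ^ valuationValue (approx π n ((ε : W) * π ^ v)) ∣
      approx π n ((ε : W) * π ^ v) :=
    Nat.findGreatest_of_ne_zero (m := valuationValue (approx π n ((ε : W) * π ^ v))) rfl
      (by omega)
  rw [approx_pow_dvd_iff hle, Units.dvd_mul_left,
    pow_dvd_pow_iff hπ.ne_zero hπ.not_isUnit] at hd
  omega

theorem reaches_liftPoly (L : LiftStrategy π) (j s k : ℕ) {m : ℕ} (n : ℕ) (P : ℕ → Approx π m) :
    Reaches (liftPoly L j s k n P)
      (ret fun i => if i < k then L.lift j s i m n (P i) else 0) n (k * 1) :=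
  reaches_forEach fun _ _ => reaches_tick _ _

/-- The coefficients of the first step of the pseudo-division. -/
def pseudoStep {R : Type*} [CommRing R] (j : ℕ) (p q : ℕ → R) (i : ℕ) : R :=
  q j * p i - p (j + 1) * (if i = 0 then 0 else q (i - 1))

theorem reaches_pseudoRem {n : ℕ} (j : ℕ) {P Q : ℕ → Approx π n} {p q : ℕ → W}
    (hP : ∀ i ≤ j + 1, P i = approx π n (p i)) (hQ : ∀ i ≤ j, Q i = approx π n (q i)) :
    Reaches (pseudoRem j P Q)
      (ret fun i => if i < j then approx π n (q j * pseudoStep j p q i -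
        pseudoStep j p q j * q i) else 0) n ((j + 1) * 3 + j * 3) := by
  have h1 : Reaches (Run.forEach (j + 1) fun i =>
      (mul (Q j) (P i)).bind fun a =>
      (mul (P (j + 1)) (if i = 0 then 0 else Q (i - 1))).bind fun b =>
      sub a b) (ret fun i => if i < j + 1 then approx π n (pseudoStep j p q i) else 0) n
      ((j + 1) * 3) := by
    refine reaches_forEach fun i hi => ?_
    have e : approx π n (pseudoStep j p q i) =
        Q j * P i - P (j + 1) * (if i = 0 then 0 else Q (i - 1)) := by
      rw [pseudoStep, map_sub, map_mul, map_mul, hP i (by omega), hP _ le_rfl, hQ _ le_rfl]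
      congr 2
      split_ifs
      · exact map_zero _
      · rw [hQ _ (by omega)]
    rw [e]
    refine (reaches_mul _ _).bind_trans (L' := 2) ((reaches_mul _ _).bind_trans (L' := 1) ?_)
    exact reaches_sub _ _
  refine h1.bind_trans (reaches_forEach fun i hi => ?_)
  have e : approx π n (q j * pseudoStep j p q i - pseudoStep j p q j * q i) =
      Q j * (if i < j + 1 then approx π n (pseudoStep j p q i) else 0) -
      (if j < j + 1 then approx π n (pseudoStep j p q j) else 0) * Q i := by
    rw [if_pos (by omega), if_pos (by omega), map_sub, map_mul, map_mul, hQ _ le_rfl,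
      hQ _ hi.le]
  rw [e]
  refine (reaches_mul _ _).bind_trans (L' := 2) ((reaches_mul _ _).bind_trans (L' := 1) ?_)
  exact reaches_sub _ _

theorem mainLoop_result_eq_none (L : LiftStrategy π) (d N j : ℕ) {m n : ℕ} (w : ℕ)
    (P : ℕ → Approx π m) (Q : ℕ → Approx π n) (out : ℕ → ℕ → Approx π N)
    (h : N ≤ 2 * valuationValue (Q (j + 1))) :
    (mainLoop L d N (j + 1) w P Q out).result = none := by
  rw [mainLoop, ((reaches_valuation (Q (j + 1))).bind _).result_eq, if_pos h]
  rfl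

/-- No subresultants enter here: p and q are exact representatives of the lifted coefficients, and ρ
is the exact quotient they produce in W. -/
theorem reaches_mainLoop_succ [IsDomain W] (hπ : π ≠ 0) (L : LiftStrategy π) (d N j : ℕ)
    {m n : ℕ} (v w : ℕ) (P : ℕ → Approx π m) (Q : ℕ → Approx π n) (out : ℕ → ℕ → Approx π N)
    (hv : valuationValue (Q (j + 1)) = v) (hN : ¬ N ≤ 2 * v) (p q ρ : ℕ → W) (ε : Wˣ)
    (hp : ∀ i ≤ j + 2, approx π (N + 2 * v + 2 * w) (p i) =
      if j + 2 = d ∧ i = d then 1 else L.lift (j + 1) 0 i m (N + 2 * v + 2 * w) (P i))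
    (hq : ∀ i ≤ j + 1, approx π (N + 2 * v + 2 * w) (q i) =
      L.lift (j + 1) 1 i n (N + 2 * v + 2 * w) (Q i))
    (hρ : ∀ i ≤ j, q (j + 1) * pseudoStep (j + 1) p q i -
        pseudoStep (j + 1) p q (j + 1) * q i = ρ i * p (j + 2) ^ 2)
    (hε : p (j + 2) ^ 2 = ε * π ^ (2 * w)) {K : ℕ} (hK : n ≤ K)
    (hK' : N + 2 * v + 2 * w ≤ K) :
    Reaches (mainLoop L d N (j + 1) w P Q out)
      (mainLoop L d N j v
        (fun i => if i < j + 2 then approx π (N + 2 * v + 2 * w) (q i) else 0)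
        (fun i => if i < j + 1 then approx π (N + 2 * v) (ρ i) else 0)
        (Function.update out j fun i => if i < j + 1 then approx π N (ρ i) else 0))
      K (9 * j + 17) := by
  -- In order: the valuation, the two lifts, the pseudo-remainder, the square, the quotients.
  rw [mainLoop, show 9 * j + 17 = 1 + ((j + 3) * 1 + ((j + 2) * 1 +
    (((j + 1 + 1) * 3 + (j + 1) * 3) + (1 + ((j + 1) * 1 + 0))))) by ring]
  refine ((reaches_valuation (Q (j + 1))).mono hK le_rfl).bind_trans ?_
  rw [hv, if_neg hN]
  refine ((reaches_liftPoly L (j + 1) 0 (j + 3) _ P).mono hK' le_rfl).bind_trans ?_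
  refine ((reaches_liftPoly L (j + 1) 1 (j + 2) _ Q).mono hK' le_rfl).bind_trans ?_
  have hQ' : (fun i => if i < j + 2 then
      L.lift (j + 1) 1 i n (N + 2 * v + 2 * w) (Q i) else 0) =
      fun i => if i < j + 2 then approx π (N + 2 * v + 2 * w) (q i) else 0 := by
    funext i
    split_ifs with hi
    · rw [hq i (by omega)]
    · rfl
  rw [hQ']
  set P' : ℕ → Approx π (N + 2 * v + 2 * w) := if j + 2 = d then Function.update (fun i =>
    if i < j + 3 then L.lift (j + 1) 0 i m (N + 2 * v + 2 * w) (P i) else 0) d 1 else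
    fun i => if i < j + 3 then L.lift (j + 1) 0 i m (N + 2 * v + 2 * w) (P i) else 0 with hP'
  have hP : ∀ i ≤ j + 2, P' i = approx π (N + 2 * v + 2 * w) (p i) := by
    intro i hi
    rw [hp i hi, hP']
    by_cases hd : j + 2 = d
    · rw [if_pos hd, Function.update_apply]
      by_cases hid : i = d
      · rw [if_pos hid, if_pos ⟨hd, hid⟩]
      · rw [if_neg hid, if_neg (show ¬(j + 2 = d ∧ i = d) from fun h => hid h.2),
          if_pos (show i < j + 3 by omega)]
    · rw [if_neg hd, if_neg (show ¬(j + 2 = d ∧ i = d) from fun h => hd h.1),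
        if_pos (show i < j + 3 by omega)]
  refine ((reaches_pseudoRem (j + 1) (p := p) (q := q) hP (fun i hi => by
    rw [if_pos (by omega)])).mono hK' le_rfl).bind_trans ?_
  refine ((reaches_mul _ _).mono hK' le_rfl).bind_trans ?_
  have hquo : Reaches (Run.forEach (j + 1) fun i => quo (n := N + 2 * v) (w := 2 * w)
      (if i < j + 1 then approx π (N + 2 * v + 2 * w) (q (j + 1) * pseudoStep (j + 1) p q i -
        pseudoStep (j + 1) p q (j + 1) * q i) else 0) (P' (j + 2) * P' (j + 2)))
      (ret fun i => if i < j + 1 then approx π (N + 2 * v) (ρ i) else 0)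
      (N + 2 * v + 2 * w) ((j + 1) * 1) := by
    refine reaches_forEach fun i hi => ?_
    rw [if_pos hi, hρ i (by omega), hP _ le_rfl, ← map_mul, ← pow_two]
    exact reaches_quo hπ hε
  refine (hquo.mono hK' le_rfl).bind_trans ?_
  have hout : (fun i => truncate (if i < j + 1 then approx π (N + 2 * v) (ρ i) else 0)) =
      fun i => if i < j + 1 then approx π N (ρ i) else (0 : Approx π N) := by
    funext i
    split_ifs
    · rfl
    · exact map_zero (Ideal.Quotient.factor _)
  rw [hout]
  exact Reaches.refl _ _

end Approximations

theorem exists_natDegree_le_coeff_eq {R : Type u} [CommRing R] (n : ℕ) (e : ℕ → R) :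
    ∃ E : R[X], E.natDegree ≤ n ∧ ∀ i ≤ n, E.coeff i = e i := by
  refine ⟨ofCoords (n + 1) fun c => e (n - c), natDegree_ofCoords_le _ _, fun i hi => ?_⟩
  rw [coeff_ofCoords, if_pos (by omega)]
  congr 1; omega

/-- The subresultant pseudo-remainder recurrence, coefficientwise. -/
theorem coeff_extSubres_recurrence {R : Type u} [CommRing R] [IsDomain R] {d j : ℕ}
    (hj : j + 1 < d) {A B : R[X]} (h : MonicPair d A B)
    (hr : principalSubres d d (j + 1) A B ≠ 0) (p q : ℕ → R) (c : R)
    (hp : ∀ i ≤ j + 2, p i = c * (extSubres d (j + 2) A B).coeff i)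
    (hq : ∀ i ≤ j + 1, q i = c * (extSubres d (j + 1) A B).coeff i) {i : ℕ} (hi : i ≤ j) :
    q (j + 1) * pseudoStep (j + 1) p q i - pseudoStep (j + 1) p q (j + 1) * q i =
      c * (extSubres d j A B).coeff i * p (j + 2) ^ 2 := by
  have key := congrArg (fun P => P.coeff i) (extSubres_recurrence hj h hr _ _ _ rfl rfl rfl)
  simp only [coeff_C_mul, coeff_sub] at key
  rw [pseudoStep, pseudoStep, if_neg (Nat.succ_ne_zero j), Nat.add_sub_cancel,
    show j + 1 + 1 = j + 2 from rfl, hp i (by omega), hp _ le_rfl, hp (j + 1) (by omega),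
    hq i (by omega), hq _ le_rfl, hq j (by omega)]
  rcases Nat.eq_zero_or_pos i with rfl | hi0
  · rw [if_pos rfl]
    rw [add_mul, coeff_add, mul_assoc, coeff_C_mul, coeff_X_mul_zero, coeff_C_mul] at key
    -- The recurrence is homogeneous of degree 3 in the two polynomials, so scaling both by c scales
    -- the quotient by c.
    linear_combination (-c ^ 3) * key
  · obtain ⟨i, rfl⟩ : ∃ i', i = i' + 1 := ⟨i - 1, by omega⟩
    rw [coeff_C_mul_X_add_C_mul] at key
    rw [if_neg (Nat.succ_ne_zero i), Nat.add_sub_cancel, hq i (by omega)]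
    linear_combination (-c ^ 3) * key

/-! ### Reduction modulo π^N and the loop invariant. -/

section Congruence

variable {W : Type u} [CommRing W] {π : W}

theorem pow_dvd_principalSubres_sub {N d : ℕ} {A B A' B' : W[X]}
    (hA : A'.map (approx π N) = A.map (approx π N))
    (hB : B'.map (approx π N) = B.map (approx π N)) (k : ℕ) :
    π ^ N ∣ principalSubres d d k A' B' - principalSubres d d k A B := by
  rw [← approx_eq_approx_iff, ← principalSubres_map, ← principalSubres_map, hA, hB]

theorem map_add_C_pow_mul (N : ℕ) (A a : W[X]) :
    (A + C (π ^ N) * a).map (approx π N) = A.map (approx π N) := by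
  have h0 : approx π N (π ^ N) = 0 :=
    Ideal.Quotient.eq_zero_iff_mem.2 (Ideal.mem_span_singleton_self _)
  rw [Polynomial.map_add, Polynomial.map_mul, map_C, h0, C_0, zero_mul, add_zero]

/-- Lifted coefficients differ from the exact ones by a multiple of the admissible error. -/
theorem exists_error_poly {N w m : ℕ} {r u : W} {ε : Wˣ} (hr : r = ε * π ^ w)
    (hm : N + 2 * w ≤ m) (k : ℕ) (S : W[X]) (p : ℕ → W)
    (hp : ∀ i ≤ k, π ^ m ∣ p i - u * S.coeff i) :
    ∃ e : W[X], e.natDegree ≤ k ∧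
      ∀ i ≤ k, p i = (C u * S + C (π ^ N * r ^ 2) * e).coeff i := by
  have hdvd : π ^ N * r ^ 2 ∣ π ^ m := by
    have e1 : π ^ N * r ^ 2 = ((ε ^ 2 : Wˣ) : W) * π ^ (N + 2 * w) := by
      rw [hr, pow_add, pow_mul', Units.val_pow_eq_pow_val]; ring
    rw [e1, Units.mul_left_dvd]
    exact pow_dvd_pow π hm
  have hex : ∀ i, ∃ t : W, i ≤ k → p i - u * S.coeff i = π ^ N * r ^ 2 * t := by
    intro i
    by_cases hi : i ≤ k
    · obtain ⟨t, ht⟩ := hdvd.trans (hp i hi)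
      exact ⟨t, fun _ => ht⟩
    · exact ⟨0, fun h => absurd h hi⟩
  choose t ht using hex
  obtain ⟨e, he, het⟩ := exists_natDegree_le_coeff_eq k t
  refine ⟨e, he, fun i hi => ?_⟩
  rw [coeff_add, coeff_C_mul, coeff_C_mul, het i hi, ← ht i hi]
  ring

/-- The state of the main loop before iteration `j`: up to a scalar congruent to `1`, the current
polynomials approximate the subresultants of index `j + 1` and `j` of a perturbation of the
input. -/
structure LoopInvariant (π : W) (d N : ℕ) (A B : W[X]) (j : ℕ) {m n : ℕ} (w : ℕ)
    (P : ℕ → Approx π m) (Q : ℕ → Approx π n) : Prop where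
  two_mul_lt : 2 * w < N
  exists_unit : ∃ ε : Wˣ, principalSubres d d (j + 1) A B = ε * π ^ w
  le_left : N + 2 * w ≤ m
  le_right : N + 2 * w ≤ n
  exists_pair : ∃ (A' B' : W[X]) (u : W), MonicPair d A' B' ∧
    A'.map (approx π N) = A.map (approx π N) ∧ B'.map (approx π N) = B.map (approx π N) ∧
    π ^ N ∣ u - 1 ∧ (j + 1 = d → u = 1) ∧
    (∀ i ≤ j + 1, P i = approx π m (u * (extSubres d (j + 1) A' B').coeff i)) ∧
    (∀ i ≤ j, Q i = approx π n (u * (extSubres d j A' B').coeff i))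

theorem LoopInvariant.result_eq_none {d N j : ℕ} {A B : W[X]} {m n w : ℕ} {P : ℕ → Approx π m}
    {Q : ℕ → Approx π n} (h : LoopInvariant π d N A B (j + 1) w P Q) (hj : j + 1 < d)
    (hr : π ^ ((N + 1) / 2) ∣ principalSubres d d (j + 1) A B) (L : LiftStrategy π)
    (out : ℕ → ℕ → Approx π N) : (mainLoop L d N (j + 1) w P Q out).result = none := by
  apply mainLoop_result_eq_none
  obtain ⟨A', B', u, hAB, hA, hB, -, -, -, hQ⟩ := h.exists_pair
  have hle := h.le_right
  -- The exponent is N/2 rounded up, hence at most N, so the perturbation of the input does not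
  -- affect this divisibility.
  have hdvd : π ^ ((N + 1) / 2) ∣ u * (extSubres d (j + 1) A' B').coeff (j + 1) := by
    rw [coeff_extSubres_self hj.le hAB]
    refine Dvd.dvd.mul_left ?_ _
    rw [← dvd_sub_left hr]
    exact (pow_dvd_pow π (by omega)).trans (pow_dvd_principalSubres_sub hA hB _)
  have := le_valuationValue (n := n) (by omega) hdvd
  rw [hQ _ le_rfl]
  omega

/-- The invariant holds when the main loop is entered. -/
theorem loopInvariant_init {d N : ℕ} (hd : 0 < d) (hN : 0 < N) {A B : W[X]}
    (hAB : MonicPair d A B) :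
    LoopInvariant π d N A B (d - 1) 0 (B.map (approx π N)).coeff
      (fun i => if i < d then approx π N ((subres d d (d - 1) A B).coeff i) else 0) where
  two_mul_lt := hN
  exists_unit := ⟨1, by
    rw [Nat.sub_add_cancel hd, principalSubres_self, pow_zero, mul_one, Units.val_one]⟩
  le_left := le_rfl
  le_right := le_rfl
  exists_pair := ⟨A, B, 1, hAB, rfl, rfl, by rw [sub_self]; exact dvd_zero _, fun _ => rfl,
    fun i _ => by rw [Nat.sub_add_cancel hd, extSubres_self, one_mul, coeff_map],
    fun i hi => by rw [if_pos (by omega), one_mul, extSubres_of_lt (by omega)]⟩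

theorem reaches_stabilizedSubres (L : LiftStrategy π) {d : ℕ} (N : ℕ) (hd : 0 < d) {A B : W[X]}
    (hAB : MonicPair d A B) :
    Reaches (stabilizedSubres L d N (A.map (approx π N)) (B.map (approx π N)))
      (mainLoop L d N (d - 1) 0 (B.map (approx π N)).coeff
        (fun i => if i < d then approx π N ((subres d d (d - 1) A B).coeff i) else 0)
        (Function.update (fun _ _ => 0) (d - 1)
          (fun i => if i < d then approx π N ((subres d d (d - 1) A B).coeff i) else 0)))
      N (d * 1) := by
  unfold stabilizedSubres
  refine Reaches.bind (reaches_forEach fun i hi => ?_) _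
  rw [← extSubres_of_lt (by omega), extSubres_pred hd hAB, coeff_sub, map_sub, coeff_map,
    coeff_map]
  exact reaches_sub _ _

end Congruence

/-! ### Valuations, preservation of the invariant, and induction over the loop. -/

section Valuation

variable {W : Type u} [CommRing W] [IsDomain W] [IsDiscreteValuationRing W] {π : W}

theorem isUnit_of_dvd_sub (hπ : Irreducible π) {a b : W} (ha : IsUnit a) (h : π ∣ b - a) :
    IsUnit b := by
  by_contra hb
  have hb' : b ∈ IsLocalRing.maximalIdeal W := (IsLocalRing.mem_maximalIdeal b).2 hb
  have hab : b - a ∈ IsLocalRing.maximalIdeal W :=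
    Ideal.mem_of_dvd _ h ((IsLocalRing.mem_maximalIdeal π).2 hπ.not_isUnit)
  have : a ∈ IsLocalRing.maximalIdeal W := by
    have := Ideal.sub_mem _ hb' hab
    rwa [sub_sub_cancel] at this
  exact (IsLocalRing.mem_maximalIdeal a).1 this ha

/-- The error modulo π^N only changes the unit by a multiple of π. This lets all perturbed inputs
share the valuations of the original one. -/
theorem exists_eq_unit_mul_pow_of_dvd_sub (hπ : Irreducible π) {N w : ℕ} (hw : w < N) {r r' : W}
    {ε : Wˣ} (hr : r = ε * π ^ w) (h : π ^ N ∣ r' - r) : ∃ ε' : Wˣ, r' = ε' * π ^ w := by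
  obtain ⟨t, ht⟩ := h
  have hu : IsUnit ((ε : W) + π ^ (N - w) * t) := by
    refine isUnit_of_dvd_sub hπ ε.isUnit ?_
    rw [add_sub_cancel_left]
    exact Dvd.dvd.mul_right (dvd_pow_self π (by omega)) t
  refine ⟨hu.unit, ?_⟩
  rw [IsUnit.unit_spec, add_mul, ← hr, mul_right_comm, ← pow_add, Nat.sub_add_cancel hw.le, ← ht]
  ring

theorem pow_dvd_or_exists_eq (hπ : Irreducible π) (N : ℕ) (r : W) :
    π ^ ((N + 1) / 2) ∣ r ∨ ∃ (v : ℕ) (ε : Wˣ), r = ε * π ^ v ∧ 2 * v < N := by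
  by_cases hr : r = 0
  · rw [hr]; exact Or.inl (dvd_zero _)
  · obtain ⟨v, ε, rfl⟩ := IsDiscreteValuationRing.eq_unit_mul_pow_irreducible hr hπ
    by_cases hv : 2 * v < N
    · exact Or.inr ⟨v, ε, rfl, hv⟩
    · exact Or.inl (Dvd.dvd.mul_left (pow_dvd_pow π (by omega)) _)

theorem exists_eq_of_two_mul_addVal_lt (hπ : Irreducible π) {N : ℕ} {r : W}
    (h : 2 * IsDiscreteValuationRing.addVal W r < (N : ℕ∞)) :
    ∃ (v : ℕ) (ε : Wˣ), r = ε * π ^ v ∧ 2 * v < N ∧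
      (IsDiscreteValuationRing.addVal W r).toNat = v := by
  have hr : r ≠ 0 := by
    rintro rfl
    rw [IsDiscreteValuationRing.addVal_zero, ENat.mul_top (by norm_num)] at h
    exact not_top_lt h
  obtain ⟨v, ε, rfl⟩ := IsDiscreteValuationRing.eq_unit_mul_pow_irreducible hr hπ
  rw [IsDiscreteValuationRing.addVal_def' ε hπ v] at h ⊢
  exact ⟨v, ε, rfl, by exact_mod_cast h, rfl⟩

theorem pow_dvd_of_le_two_mul_addVal (hπ : Irreducible π) {N : ℕ} {r : W}
    (h : (N : ℕ∞) ≤ 2 * IsDiscreteValuationRing.addVal W r) : π ^ ((N + 1) / 2) ∣ r := by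
  rcases pow_dvd_or_exists_eq hπ N r with h' | ⟨v, ε, rfl, hv⟩
  · exact h'
  · rw [IsDiscreteValuationRing.addVal_def' ε hπ v] at h
    have : N ≤ 2 * v := by exact_mod_cast h
    omega

/-- One iteration of the main loop preserves the invariant and outputs the next subresultant. -/
theorem LoopInvariant.step (hπ : Irreducible π) {d N j : ℕ} {A B : W[X]} (hAB₀ : MonicPair d A B)
    {m n w : ℕ} {P : ℕ → Approx π m}
    {Q : ℕ → Approx π n} (h : LoopInvariant π d N A B (j + 1) w P Q) (hj : j + 1 < d)
    {v : ℕ} {δ : Wˣ} (hδ : principalSubres d d (j + 1) A B = δ * π ^ v) (hv : 2 * v < N)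
    (L : LiftStrategy π) (out : ℕ → ℕ → Approx π N) {K : ℕ} (hK : n ≤ K)
    (hK' : N + 2 * v + 2 * w ≤ K) :
    ∃ (P' : ℕ → Approx π (N + 2 * v + 2 * w)) (Q' : ℕ → Approx π (N + 2 * v)),
      LoopInvariant π d N A B j v P' Q' ∧
      Reaches (mainLoop L d N (j + 1) w P Q out)
        (mainLoop L d N j v P' Q'
          (Function.update out j fun i => approx π N ((subres d d j A B).coeff i)))
        K (9 * d) := by
  obtain ⟨A', B', u, hAB, hA, hB, hu, hud, hP, hQ⟩ := h.exists_pair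
  obtain ⟨ε₀, hε₀⟩ := h.exists_unit
  have hwN := h.two_mul_lt
  obtain ⟨ε, hε⟩ := exists_eq_unit_mul_pow_of_dvd_sub hπ (by omega : w < N) hε₀
    (pow_dvd_principalSubres_sub hA hB (j + 2))
  obtain ⟨δ', hδ'⟩ := exists_eq_unit_mul_pow_of_dvd_sub hπ (by omega : v < N) hδ
    (pow_dvd_principalSubres_sub hA hB (j + 1))
  have hπN : π ∣ π ^ N := dvd_pow_self π (by omega)
  -- A common element of the old and new balls represents both, whether digits were added or
  -- dropped, so one exact polynomial serves before and after the change of precision.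
  choose a ha₁ ha₂ using fun i => L.meets (j + 1) 0 i m (N + 2 * v + 2 * w) (P i)
  choose q hq₁ hq₂ using fun i => L.meets (j + 1) 1 i n (N + 2 * v + 2 * w) (Q i)
  set p : ℕ → W := fun i => if j + 2 = d ∧ i = d then 1 else a i with hp
  have hpdvd : ∀ i ≤ j + 2, π ^ m ∣ p i - u * (extSubres d (j + 2) A' B').coeff i := by
    intro i hi
    by_cases hc : j + 2 = d ∧ i = d
    · simp only [hp, if_pos hc]
      -- At the first iteration the leading coefficient is reset to exactly 1, which is compatible
      -- with the scalar because u = 1 there.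
      rw [hud hc.1, hc.2, ← hc.1, extSubres_self, hc.1, hAB.coeff_right]
      simp
    · simp only [hp, if_neg hc]
      rw [← approx_eq_approx_iff, ha₁, hP i hi]
  have hqdvd : ∀ i ≤ j + 1, π ^ n ∣ q i - u * (extSubres d (j + 1) A' B').coeff i := by
    intro i hi
    rw [← approx_eq_approx_iff, hq₁, hQ i hi]
  obtain ⟨e₁, he₁, hpe⟩ := exists_error_poly hε h.le_left (j + 2) _ p hpdvd
  obtain ⟨e₀, he₀, hqe⟩ := exists_error_poly hε h.le_right (j + 1) _ q hqdvd
  have hu₁N : π ^ N ∣ u + π ^ N * principalSubres d d (j + 2) A' B' * e₁.coeff (j + 2) - 1 := by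
    rw [add_sub_right_comm]
    exact dvd_add hu (Dvd.dvd.mul_right (dvd_mul_right _ _) _)
  obtain ⟨u₁, hu₁⟩ : IsUnit (u + π ^ N * principalSubres d d (j + 2) A' B' *
      e₁.coeff (j + 2)) := isUnit_of_dvd_sub hπ isUnit_one (hπN.trans hu₁N)
  rw [← hu₁] at hu₁N
  have hr : principalSubres d d (j + 2) A' B' ≠ 0 := by
    rw [hε]; exact mul_ne_zero ε.ne_zero (pow_ne_zero _ hπ.ne_zero)
  -- The chosen representatives become exact multiples of subresultants of a new input, still
  -- congruent to the original modulo π^N.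
  obtain ⟨A₂, B₂, s, t, hAB₂, hA₂, hB₂, hX₁, hX₀⟩ := exists_lift (j := j + 1) hj hAB hr (π ^ N) u
    u₁ e₁ e₀ he₁ he₀ hu₁
  have hA₂' : A₂.map (approx π N) = A.map (approx π N) := by
    rw [hA₂, map_add_C_pow_mul, hA]
  have hB₂' : B₂.map (approx π N) = B.map (approx π N) := by
    rw [hB₂, map_add_C_pow_mul, hB]
  have hp₂ : ∀ i ≤ j + 2, p i = u₁ * (extSubres d (j + 2) A₂ B₂).coeff i := by
    intro i hi
    rw [hpe i hi, hX₁, coeff_C_mul]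
  have hq₂' : ∀ i ≤ j + 1, q i = u₁ * (extSubres d (j + 1) A₂ B₂).coeff i := by
    intro i hi
    rw [hqe i hi, hX₀, coeff_C_mul]
  obtain ⟨ε₂, hε₂⟩ := exists_eq_unit_mul_pow_of_dvd_sub hπ (by omega : w < N) hε₀
    (pow_dvd_principalSubres_sub hA₂' hB₂' (j + 2))
  obtain ⟨δ₂, hδ₂⟩ := exists_eq_unit_mul_pow_of_dvd_sub hπ (by omega : v < N) hδ
    (pow_dvd_principalSubres_sub hA₂' hB₂' (j + 1))
  have hr₂ : principalSubres d d (j + 1) A₂ B₂ ≠ 0 := by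
    rw [hδ₂]; exact mul_ne_zero δ₂.ne_zero (pow_ne_zero _ hπ.ne_zero)
  have hvn : v ≤ n := by have := h.le_right; omega
  have hval : valuationValue (Q (j + 1)) = v := by
    obtain ⟨u', rfl⟩ : IsUnit u := isUnit_of_dvd_sub hπ isUnit_one (hπN.trans hu)
    rw [hQ _ le_rfl, coeff_extSubres_self hj.le hAB, hδ', ← mul_assoc, ← Units.val_mul]
    exact valuationValue_eq hπ hvn
  have hout : (fun i => if i < j + 1 then approx π N (u₁ * (extSubres d j A₂ B₂).coeff i) else 0) =
      fun i => approx π N ((subres d d j A B).coeff i) := by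
    funext i
    have hjd : j < d := by omega
    split_ifs with hi
    · rw [extSubres_of_lt hjd, ← coeff_map, ← subres_map, ← hA₂', ← hB₂', subres_map, coeff_map,
        approx_eq_approx_iff, ← sub_one_mul]
      exact Dvd.dvd.mul_right hu₁N _
    · rw [← extSubres_of_lt hjd, coeff_extSubres hjd.le hAB₀ (by omega), if_neg (by omega),
        map_zero]
  have hreach := reaches_mainLoop_succ hπ.ne_zero L d N j v w P Q out hval (by omega) p q
    (fun i => u₁ * (extSubres d j A₂ B₂).coeff i) ((u₁ * ε₂) ^ 2)
    (fun i hi => by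
      by_cases hc : j + 2 = d ∧ i = d
      · simp only [hp, if_pos hc, map_one]
      · simp only [hp, if_neg hc, ha₂])
    (fun i _ => hq₂ i)
    (fun i hi => coeff_extSubres_recurrence hj hAB₂ hr₂ p q u₁ hp₂ hq₂' hi)
    (by
      rw [hp₂ _ le_rfl, coeff_extSubres_self hj hAB₂, hε₂, Units.val_pow_eq_pow_val,
        Units.val_mul, pow_mul']
      ring) hK hK'
  rw [hout] at hreach
  refine ⟨_, _, ⟨hv, ⟨δ, hδ⟩, by omega, le_rfl, A₂, B₂, u₁, hAB₂, hA₂', hB₂', hu₁N,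
    fun hd => absurd hd (by omega), fun i hi => ?_, fun i hi => ?_⟩,
    hreach.mono le_rfl (by omega)⟩
  · rw [if_pos (by omega), hq₂' i hi]
  · rw [if_pos (by omega)]

/-- When all principal subresultants have small valuation, the main loop computes all
subresultants. -/
theorem LoopInvariant.reaches (hπ : Irreducible π) {d N : ℕ} {A B : W[X]} (hAB : MonicPair d A B)
    (L : LiftStrategy π) (X : ℕ) : ∀ (j : ℕ) {m n w : ℕ} {P : ℕ → Approx π m}
    {Q : ℕ → Approx π n} (_ : LoopInvariant π d N A B j w P Q) (_ : j < d) (_ : w ≤ X)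
    (_ : n ≤ 2 * (N + X)) (_ : ∀ k, 1 ≤ k → k ≤ j → ∃ (v : ℕ) (ε : Wˣ),
      principalSubres d d k A B = ε * π ^ v ∧ 2 * v < N ∧ v ≤ X) (out : ℕ → ℕ → Approx π N),
    ∃ res : ℕ → ℕ → Approx π N,
      Reaches (mainLoop L d N j w P Q out) (ret res) (2 * (N + X)) (j * (9 * d)) ∧
      (∀ k < j, ∀ i, res k i = approx π N ((subres d d k A B).coeff i)) ∧
      ∀ k, j ≤ k → res k = out k := by
  intro j
  induction j with
  | zero =>
    intro m n w P Q _ _ _ _ _ out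
    refine ⟨out, ?_, fun k hk => absurd hk (Nat.not_lt_zero k), fun _ _ => rfl⟩
    rw [mainLoop, Nat.zero_mul]
    exact Reaches.refl _ _
  | succ j ih =>
    intro m n w P Q h hj hw hn hval out
    obtain ⟨v, δ, hδ, hv, hvX⟩ := hval (j + 1) (by omega) le_rfl
    have hwN := h.two_mul_lt
    -- N + 2v + 2w ≤ 2 (N + X) because 2w < N and v ≤ X.
    obtain ⟨P', Q', h', hreach⟩ := h.step hπ hAB hj hδ hv L out hn (by omega)
    obtain ⟨res, hres, hlow, hhigh⟩ := ih h' (by omega) hvX (by omega)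
      (fun k hk hk' => hval k hk (by omega)) _
    refine ⟨res, (hreach.trans hres).mono le_rfl (by rw [Nat.add_mul j 1, Nat.one_mul, Nat.add_comm]),
      fun k hk i => ?_, fun k hk => ?_⟩
    · rcases (Nat.le_of_lt_succ hk).eq_or_lt with rfl | hk'
      · rw [hhigh k le_rfl, Function.update_self]
      · exact hlow k hk' i
    · rw [hhigh k (by omega), Function.update_of_ne (by omega)]

/-- When a principal subresultant has large valuation, the main loop raises an error. -/
theorem LoopInvariant.mainLoop_result_eq_none (hπ : Irreducible π) {d N : ℕ} {A B : W[X]}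
    (hAB : MonicPair d A B) (L : LiftStrategy π) : ∀ (j : ℕ) {m n w : ℕ} {P : ℕ → Approx π m}
    {Q : ℕ → Approx π n} (_ : LoopInvariant π d N A B j w P Q) (_ : j < d)
    (_ : ∃ k, 1 ≤ k ∧ k ≤ j ∧ π ^ ((N + 1) / 2) ∣ principalSubres d d k A B)
    (out : ℕ → ℕ → Approx π N), (mainLoop L d N j w P Q out).result = none := by
  intro j
  induction j with
  | zero =>
    rintro m n w P Q _ _ ⟨k, hk, hk', -⟩
    omega
  | succ j ih =>
    rintro m n w P Q h hj ⟨k, hk, hkj, hdvd⟩ out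
    rcases pow_dvd_or_exists_eq hπ N (principalSubres d d (j + 1) A B) with h0 | ⟨v, δ, hδ, hv⟩
    · exact h.result_eq_none hj h0 L out
    · obtain ⟨P', Q', h', hreach⟩ := h.step hπ hAB hj hδ hv L out (le_max_left n _)
        (le_max_right _ _)
      rw [hreach.result_eq]
      refine ih h' (by omega) ⟨k, hk, ?_, hdvd⟩ _
      rcases hkj.eq_or_lt with rfl | hlt
      -- The index just passed has small valuation, so the bad index is strictly lower.
      · rw [hδ, Units.dvd_mul_left, pow_dvd_pow_iff hπ.ne_zero hπ.not_isUnit] at hdvd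
        omega
      · omega

end Valuation

end StableSubres

theorem proposition4p7 :
    ∃ C : ℕ, ∀ (W : Type*) [CommRing W] [IsDomain W] [IsDiscreteValuationRing W]
      [IsAdicComplete (IsLocalRing.maximalIdeal W) W] (π : W) (_ : Irreducible π)
      (L : StableSubres.LiftStrategy π) (d N : ℕ) (_ : 0 < d) (A B : Polynomial W)
      (_ : A.Monic) (_ : A.natDegree = d) (_ : B.Monic) (_ : B.natDegree = d),
      -- (H): no principal subresultant vanishes modulo `π^(N/2)`
      ((∀ j < d, 2 * IsDiscreteValuationRing.addVal W (StableSubres.principalSubres d d j A B)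
          < (N : ℕ∞)) →
        -- correctness
        (∃ out : ℕ → ℕ → StableSubres.Approx π N,
          (StableSubres.stabilizedSubres L d N (A.map (StableSubres.approx π N))
            (B.map (StableSubres.approx π N))).result = some out ∧
          ∀ j < d, ∀ i : ℕ,
            out j i = StableSubres.approx π N ((StableSubres.subres d d j A B).coeff i)) ∧
        -- complexity
        (∀ (M : ℕ → ℕ) (c : ℕ), Monotone M → (∀ n ≥ 1, M (2 * n) ≤ c * M n) →
          (StableSubres.stabilizedSubres L d N (A.map (StableSubres.approx π N))
            (B.map (StableSubres.approx π N))).bitCost M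
            ≤ C * c * d ^ 2 * M (N + StableSubres.maxVal d A B))) ∧
      -- otherwise the algorithm returns an error
      ((∃ j, 1 ≤ j ∧ j < d ∧ (N : ℕ∞) ≤
          2 * IsDiscreteValuationRing.addVal W (StableSubres.principalSubres d d j A B)) →
        (StableSubres.stabilizedSubres L d N (A.map (StableSubres.approx π N))
          (B.map (StableSubres.approx π N))).result = none) := by
  -- The d initial subtractions and d - 1 iterations of at most 9d operations add up to at most 9d²
  -- operations; the factor c pays for a single doubling of the precision.
  refine ⟨9, ?_⟩
  intro W _ _ _ _ π hπ L d N hd A B hA hAd hB hBd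
  have hAB : StableSubres.MonicPair d A B := ⟨hA, hAd, hB, hBd⟩
  have hstart := StableSubres.reaches_stabilizedSubres L N hd hAB
  constructor
  · intro H
    have hN : 0 < N := by
      have h0 := H 0 hd
      exact Nat.cast_pos.1 (lt_of_le_of_lt (zero_le (a := 2 * IsDiscreteValuationRing.addVal W
        (StableSubres.principalSubres d d 0 A B))) h0)
    obtain ⟨res, hres, hlow, hhigh⟩ := (StableSubres.loopInvariant_init hd hN hAB).reaches hπ hAB L
      (StableSubres.maxVal d A B) (d - 1) (by omega) (Nat.zero_le _) (by omega)
      (fun k _ hk => by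
        obtain ⟨v, ε, h1, h2, h3⟩ :=
          StableSubres.exists_eq_of_two_mul_addVal_lt hπ (H k (by omega))
        refine ⟨v, ε, h1, h2, ?_⟩
        rw [← h3]
        exact Finset.le_sup (f := fun j => (IsDiscreteValuationRing.addVal W
          (StableSubres.principalSubres d d j A B)).toNat) (Finset.mem_range.2 (by omega))) _
    have hall := (hstart.mono (by omega) le_rfl).trans hres
    refine ⟨⟨res, hall.result_eq, fun j hj i => ?_⟩, fun M c hM hc => ?_⟩
    · rcases (show j ≤ d - 1 by omega).eq_or_lt with rfl | hj'
      · rw [hhigh _ le_rfl, Function.update_self]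
        split_ifs with hi
        · rfl
        · rw [StableSubres.coeff_subres hj hAd.le hBd.le (by omega), if_neg (by omega), map_zero]
      · exact hlow j hj' i
    · refine (hall.bitCost_le hM).trans ?_
      have hL : d * 1 + (d - 1) * (9 * d) ≤ 9 * d ^ 2 := by
        obtain ⟨e, rfl⟩ : ∃ e, d = e + 1 := ⟨d - 1, by omega⟩
        rw [Nat.add_sub_cancel]
        nlinarith
      calc (d * 1 + (d - 1) * (9 * d)) * M (2 * (N + StableSubres.maxVal d A B))
          ≤ 9 * d ^ 2 * (c * M (N + StableSubres.maxVal d A B)) :=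
            Nat.mul_le_mul hL (hc _ (by omega))
        _ = 9 * c * d ^ 2 * M (N + StableSubres.maxVal d A B) := by ring
  · rintro ⟨j, hj1, hjd, hj⟩
    rw [hstart.result_eq]
    -- For N = 0 the invariant's strict bound 2w < N fails, but d ≥ 2 and the first test already
    -- raises the error.
    rcases Nat.eq_zero_or_pos N with rfl | hN
    · obtain ⟨e, he⟩ : ∃ e, d - 1 = e + 1 := ⟨d - 2, by omega⟩
      rw [he]
      exact StableSubres.mainLoop_result_eq_none _ _ _ _ _ _ _ _ (Nat.zero_le _)
    · exact (StableSubres.loopInvariant_init hd hN hAB).mainLoop_result_eq_none hπ hAB L (d - 1)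
        (by omega) ⟨j, hj1, by omega, StableSubres.pow_dvd_of_le_two_mul_addVal hπ hj⟩ _
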